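/- All algebras are unital associative over $\mathbb{C}$, homomorphisms are unital and continuous, and modules are unital. A $\widehat\otimes$-algebra is a complete Hausdorff locally convex algebra with jointly continuous multiplication; a $\widehat\otimes$-bimodule is a complete Hausdorff locally convex bimodule with jointly continuous actions, and bimodule morphisms are continuous. For a right $A$-$\widehat\otimes$-module $X$ and a left $A$-$\widehat\otimes$-module $Y$, $X\widehat\otimes_A Y$ is the completion of the quotient of the complete projective tensor product $X\widehat\otimes Y$ by the closed linear span of all $x\cdot a\otimes y-x\otimes a\cdot y$. An $R$-$\widehat\otimes$-algebra is a $\widehat\otimes$-algebra $A$ with a $\widehat\otimes$-algebra homomorphism $\eta_A\colon R\to A$. Definitions. (a) A homomorphism $f\colon A\to B$ of $\widehat\otimes$-algebras satisfies Property (UDE) if for every $B$-$\widehat\otimes$-bimodule $X$ the map $D\mapsto D\circ f$ from the continuous derivations $B\to X$ to the continuous derivations $A\to X$ (with $X$ an $A$-bimodule via $f$) is bijective. (b) An $R$-$\widehat\otimes$-algebra $A$ is relatively quasi-free over $R$ if every admissible singular $R$-extension of $A$ splits. Here a singular $R$-extension is a surjective homomorphism $\sigma\colon E\to A$ of $R$-$\widehat\otimes$-algebras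 (so $\sigma\eta_E=\eta_A$) with $(\ker\sigma)^2=0$; it is admissible if $\sigma$ has a right inverse that is an $R$-$\widehat\otimes$-bimodule morphism, and it splits if $\sigma$ has a right inverse $j$ that is a homomorphism of $R$-$\widehat\otimes$-algebras (so $j\eta_A=\eta_E$). (c) An $A$-$\widehat\otimes$-bimodule $P$ is projective in $(A,R)\text{-mod-}(A,R)$ if every morphism $P\to Z$ of $A$-$\widehat\otimes$-bimodules lifts along every morphism $Y\to Z$ of $A$-$\widehat\otimes$-bimodules that has a right inverse in the category of $R$-$\widehat\otimes$-bimodules. A projective resolution of $A$ in $(A,R)\text{-mod-}(A,R)$ is a complex $0\leftarrow A\leftarrow P_0\leftarrow P_1\leftarrow\cdots$ of $A$-$\widehat\otimes$-bimodules with all $P_n$ projective in this sense that splits in $R\text{-mod-}R$, i.e. has a contracting homotopy consisting of $R$-$\widehat\otimes$-bimodule morphisms. (d) Let $A$ be an $R$-$\widehat\otimes$-algebra, $B$ an $S$-$\widehat\otimes$-algebra, and $(f,g)$ an $R$-$S$-homomorphism, i.e. $f\colon A\to B$ and $g\colon R\to S$ are $\widehat\otimes$-algebra homomorphisms with $f\eta_A=\eta_B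 g$. Then $f$ is a two-sided relative homological epimorphism if $f$ is an epimorphism in the category of $\widehat\otimes$-algebras and the functor $B\widehat\otimes_A(-)\widehat\otimes_A B$ sends some (equivalently, each) projective resolution $0\leftarrow A\leftarrow P_\bullet$ of $A$ in $(A,R)\text{-mod-}(A,R)$ to a sequence $0\leftarrow B\widehat\otimes_A A\widehat\otimes_A B\leftarrow B\widehat\otimes_A P_\bullet\widehat\otimes_A B$ that splits in $S\text{-mod-}S$. Theorem. Let $(f,g)$ be an $R$-$S$-homomorphism from an $R$-$\widehat\otimes$-algebra $A$ to an $S$-$\widehat\otimes$-algebra $B$. Suppose that (1) $g\colon R\to S$ has dense range; (2) $f\colon A\to B$ satisfies Property (UDE) and has dense range; (3) $A$ is relatively quasi-free over $R$. Then $f$ is a two-sided relative homological epimorphism. -/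

import Mathlib

open scoped TensorProduct Topology
open UniformSpace (Completion)

universe u

/-! ### Complete locally convex spaces and `⊗̂`-algebras -/

/-- Locally convex spaces over `ℂ` (not necessarily Hausdorff or complete). -/
class IsLCS (E : Type*) [AddCommGroup E] [Module ℂ E] [UniformSpace E] : Prop
    extends IsUniformAddGroup E, ContinuousSMul ℂ E, LocallyConvexSpace ℝ E

/-- Complete Hausdorff locally convex spaces over `ℂ`. -/
class IsCompleteLCS (E : Type*) [AddCommGroup E] [Module ℂ E] [UniformSpace E] : Prop
    extends IsLCS E, CompleteSpace E, T2Space E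

/-- A `⊗̂`-algebra: a unital associative complex algebra whose underlying space is a complete
Hausdorff locally convex space and whose multiplication is jointly continuous. -/
class IsTensorHatAlgebra (A : Type*) [Ring A] [Algebra ℂ A] [UniformSpace A] : Prop
    extends IsCompleteLCS A, ContinuousMul A

section Aux

variable {E F G : Type*}
  [AddCommGroup E] [Module ℂ E] [UniformSpace E]
  [AddCommGroup F] [Module ℂ F] [UniformSpace F]
  [AddCommGroup G] [Module ℂ G] [UniformSpace G]

theorem IsLCS.polynormable [IsLCS E] : PolynormableSpace ℂ E := by
  have : ContinuousSMul ℝ E := IsScalarTower.continuousSMul ℂ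
  open scoped ComplexOrder in
  exact @LocallyConvexSpace.toPolynormableSpace ℂ E _ _ _ _ _ _ _ _ _
    ⟨fun x => (LocallyConvexSpace.convex_basis (𝕜 := ℝ) x).to_hasBasis
      (fun s hs => ⟨s, ⟨hs.1, (convex_of_nonneg_surjective_algebraMap _
        (fun _ h => RCLike.nonneg_iff_exists_ofReal.mp h) hs.2)⟩, subset_rfl⟩)
      (fun s hs => ⟨s, ⟨hs.1, hs.2.lift ℝ⟩, subset_rfl⟩)⟩

theorem IsLCS.exists_seminorm [IsLCS E] {U : Set E} (hU : U ∈ 𝓝 (0 : E)) :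
    ∃ p : Seminorm ℂ E, Continuous p ∧ ∀ x, p x < 1 → x ∈ U := by
  have := IsLCS.polynormable (E := E)
  have hw := PolynormableSpace.withSeminorms ℂ E
  obtain ⟨s, r, hr, hs⟩ := (hw.mem_nhds_iff 0 U).1 hU
  set P : Seminorm ℂ E := s.sup (fun p : {p : Seminorm ℂ E // Continuous p} => p.1) with hP
  have hc : Continuous P := Seminorm.continuous_finsetSup fun i _ => i.2
  refine ⟨Real.toNNReal r⁻¹ • P, ?_, fun x hx => hs ?_⟩
  · exact (continuous_const.mul hc : Continuous fun x => (Real.toNNReal r⁻¹ : ℝ) * P x)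
  · rw [Seminorm.mem_ball, sub_zero]
    have : r⁻¹ * P x < 1 := by
      have h : (Real.toNNReal r⁻¹ : ℝ) * P x < 1 := hx
      rwa [Real.coe_toNNReal _ (by positivity)] at h
    rwa [inv_mul_lt_iff₀ hr, mul_one] at this

theorem IsLCS.exists_bound [IsLCS E] [IsLCS F] (b : E →ₗ[ℂ] F →ₗ[ℂ] G)
    (hb : Continuous fun z : E × F => b z.1 z.2) {r : Seminorm ℂ G} (hr : Continuous r) :
    ∃ (p : Seminorm ℂ E) (q : Seminorm ℂ F), Continuous p ∧ Continuous q ∧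
      ∀ x y, r (b x y) ≤ p x * q y := by
  have hU : {z : E × F | r (b z.1 z.2) < 1} ∈ 𝓝 ((0, 0) : E × F) :=
    (isOpen_lt (hr.comp hb) continuous_const).mem_nhds (by simp)
  rw [nhds_prod_eq, Filter.mem_prod_iff] at hU
  obtain ⟨U, hU, V, hV, hUV⟩ := hU
  obtain ⟨p, hp, hpU⟩ := IsLCS.exists_seminorm hU
  obtain ⟨q, hq, hqV⟩ := IsLCS.exists_seminorm hV
  refine ⟨p, q, hp, hq, fun x y => ?_⟩
  have key : ∀ ε : ℝ, 0 < ε → r (b x y) ≤ (p x + ε) * (q y + ε) := by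
    intro ε hε
    have h1 : 0 < p x + ε := add_pos_of_nonneg_of_pos (apply_nonneg p x) hε
    have h2 : 0 < q y + ε := add_pos_of_nonneg_of_pos (apply_nonneg q y) hε
    have hx : (((p x + ε)⁻¹ : ℝ) : ℂ) • x ∈ U := hpU _ (by
      rw [map_smul_eq_mul, Complex.norm_real, Real.norm_of_nonneg (by positivity),
        inv_mul_lt_iff₀ h1]; linarith)
    have hy : (((q y + ε)⁻¹ : ℝ) : ℂ) • y ∈ V := hqV _ (by
      rw [map_smul_eq_mul, Complex.norm_real, Real.norm_of_nonneg (by positivity),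
        inv_mul_lt_iff₀ h2]; linarith)
    have := hUV (Set.mk_mem_prod hx hy)
    simp only [Set.mem_ofPred_eq, map_smul, LinearMap.smul_apply, map_smul_eq_mul,
      Complex.norm_real] at this
    rw [Real.norm_of_nonneg (by positivity), Real.norm_of_nonneg (by positivity),
      inv_mul_lt_iff₀ h2, inv_mul_lt_iff₀ h1] at this
    linarith
  have hlim : Filter.Tendsto (fun ε : ℝ => (p x + ε) * (q y + ε)) (𝓝[>] 0)
      (𝓝 ((p x + 0) * (q y + 0))) :=
    Filter.Tendsto.mono_left (Continuous.tendsto (by fun_prop) 0) nhdsWithin_le_nhds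
  rw [add_zero, add_zero] at hlim
  exact ge_of_tendsto hlim (Filter.eventually_of_mem self_mem_nhdsWithin key)

theorem continuousAt_of_seminorm_bound {ι : Type*} [Nonempty ι] {s : SeminormFamily ℂ G ι}
    (hs : WithSeminorms s) (b : E →ₗ[ℂ] F →ₗ[ℂ] G)
    (h : ∀ i, ∃ (p : Seminorm ℂ E) (q : Seminorm ℂ F), Continuous p ∧ Continuous q ∧
      ∀ x y, s i (b x y) ≤ p x * q y)
    {α : Type*} [TopologicalSpace α] (u : α → E) (v : α → F) (a : α)
    (hu : Continuous u) (hv : Continuous v) (h0 : u a = 0 ∨ v a = 0) :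
    ContinuousAt (fun z => b (u z) (v z)) a := by
  have hb0 : b (u a) (v a) = 0 := by rcases h0 with h0 | h0 <;> simp [h0]
  rw [ContinuousAt, hs.tendsto_nhds]
  intro i ε hε
  obtain ⟨p, q, hp, hq, hpq⟩ := h i
  have hc : Continuous fun z => p (u z) * q (v z) := (hp.comp hu).mul (hq.comp hv)
  have h1 : p (u a) * q (v a) < ε := by rcases h0 with h0 | h0 <;> simpa [h0] using hε
  filter_upwards [(isOpen_lt hc continuous_const).mem_nhds h1] with z hz
  rw [hb0, sub_zero]
  exact (hpq _ _).trans_lt hz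

theorem continuous_of_seminorm_bound {ι : Type*} [Nonempty ι] [IsTopologicalAddGroup E]
    [IsTopologicalAddGroup F] {s : SeminormFamily ℂ G ι} (hs : WithSeminorms s)
    (b : E →ₗ[ℂ] F →ₗ[ℂ] G)
    (h : ∀ i, ∃ (p : Seminorm ℂ E) (q : Seminorm ℂ F), Continuous p ∧ Continuous q ∧
      ∀ x y, s i (b x y) ≤ p x * q y) :
    Continuous fun z : E × F => b z.1 z.2 := by
  have := hs.topologicalAddGroup
  let f : E →+ F →+ G := AddMonoidHom.mk' (fun x => (b x).toAddMonoidHom)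
    (fun x y => by ext; simp)
  exact continuous_of_continuousAt_zero₂ f
    (continuousAt_of_seminorm_bound hs b h (fun z : E × F => z.1) (fun z => z.2) (0, 0)
      continuous_fst continuous_snd (.inl rfl))
    (fun x => continuousAt_of_seminorm_bound hs b h (fun _ : F => x) (fun y => y) 0
      continuous_const continuous_id (.inr rfl))
    (fun y => continuousAt_of_seminorm_bound hs b h (fun x : E => x) (fun _ => y) (0 : E)
      continuous_id continuous_const (.inl rfl))

end Aux

/-! ### The projective tensor product -/
section ProjTensor

variable (E F : Type u)
  [AddCommGroup E] [Module ℂ E] [UniformSpace E]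
  [AddCommGroup F] [Module ℂ F] [UniformSpace F]

/-- The algebraic tensor product `E ⊗ F`, to be equipped with the projective topology. -/
def ProjTensor : Type u := E ⊗[ℂ] F

namespace ProjTensor

noncomputable instance : AddCommGroup (ProjTensor E F) :=
  inferInstanceAs (AddCommGroup (E ⊗[ℂ] F))

noncomputable instance : Module ℂ (ProjTensor E F) :=
  inferInstanceAs (Module ℂ (E ⊗[ℂ] F))

variable {E F}

/-- The canonical bilinear map `E × F → E ⊗ F`. -/
noncomputable def tmul : E →ₗ[ℂ] F →ₗ[ℂ] ProjTensor E F := TensorProduct.mk ℂ E F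

variable (E F)

/-- Seminorms `r` on `E ⊗ F` with `r (x ⊗ y) ≤ p x * q y` for some continuous seminorms `p` on `E`
and `q` on `F`, i.e. those dominated by the projective seminorm of some such `p` and `q`. -/
def IsProjSeminorm (r : Seminorm ℂ (ProjTensor E F)) : Prop :=
  ∃ (p : Seminorm ℂ E) (q : Seminorm ℂ F), Continuous p ∧ Continuous q ∧
    ∀ x y, r (tmul x y) ≤ p x * q y

/-- The family of seminorms that defines the projective topology. -/
def seminorms : SeminormFamily ℂ (ProjTensor E F) {r // IsProjSeminorm E F r} := fun r => r.1

instance : Nonempty {r // IsProjSeminorm E F r} :=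
  ⟨⟨0, 0, 0, continuous_const, continuous_const, fun x y => by simp⟩⟩

/-- The projective topology, the finest locally convex topology for which the canonical bilinear map
is jointly continuous. -/
noncomputable instance : TopologicalSpace (ProjTensor E F) :=
  (seminorms E F).moduleFilterBasis.topology

theorem withSeminorms : WithSeminorms (seminorms E F) := ⟨rfl⟩

instance : IsTopologicalAddGroup (ProjTensor E F) := (withSeminorms E F).topologicalAddGroup

noncomputable instance : UniformSpace (ProjTensor E F) :=
  IsTopologicalAddGroup.rightUniformSpace (ProjTensor E F)

instance : IsLCS (ProjTensor E F) :=
  { isUniformAddGroup_of_addCommGroup, (withSeminorms E F).continuousSMul,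
    (withSeminorms E F).toLocallyConvexSpace with }

variable {E F}

theorem induction_on {motive : ProjTensor E F → Prop} (t : ProjTensor E F)
    (tmul : ∀ x y, motive (tmul x y)) (add : ∀ s t, motive s → motive t → motive (s + t)) :
    motive t :=
  TensorProduct.induction_on (motive := motive) t
    (by have := tmul 0 0; rwa [map_zero] at this) tmul add

theorem continuous_tmul [IsLCS E] [IsLCS F] :
    Continuous fun z : E × F => (tmul z.1 z.2 : ProjTensor E F) :=
  continuous_of_seminorm_bound (withSeminorms E F) tmul fun r => r.2

theorem exists_seminorm (p : Seminorm ℂ E) (q : Seminorm ℂ F) :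
    ∃ P : Seminorm ℂ (ProjTensor E F), (∀ x y, P (tmul x y) ≤ p x * q y) ∧
      ∀ r : Seminorm ℂ (ProjTensor E F), (∀ x y, r (tmul x y) ≤ p x * q y) → r ≤ P := by
  let S : Set (Seminorm ℂ (ProjTensor E F)) := {r | ∀ x y, r (tmul x y) ≤ p x * q y}
  have hS : BddAbove S := by
    rw [Seminorm.bddAbove_iff]
    have : ∀ t : ProjTensor E F, ∃ M, ∀ r ∈ S, r t ≤ M := by
      intro t
      induction t using induction_on with
      | tmul x y => exact ⟨p x * q y, fun r hr => hr x y⟩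
      | add s t hs ht =>
        obtain ⟨M, hM⟩ := hs
        obtain ⟨N, hN⟩ := ht
        exact ⟨M + N, fun r hr => (map_add_le_add r s t).trans (add_le_add (hM r hr) (hN r hr))⟩
    choose M hM using this
    refine ⟨M, ?_⟩
    rintro _ ⟨r, hr, rfl⟩ t
    exact hM t r hr
  have h0 : (0 : Seminorm ℂ (ProjTensor E F)) ∈ S := fun x y =>
    mul_nonneg (apply_nonneg p x) (apply_nonneg q y)
  refine ⟨sSup S, fun x y => ?_, fun r hr => le_csSup hS hr⟩
  have : Nonempty S := ⟨⟨0, h0⟩⟩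
  rw [Seminorm.sSup_apply hS]
  exact ciSup_le fun r => r.2 x y

/-- Criterion for joint continuity of a bilinear map on a projective tensor product. -/
theorem continuous_bilinear {C : Type*} [AddCommGroup C] [Module ℂ C] [UniformSpace C]
    [IsTopologicalAddGroup C] {G : Type*} [AddCommGroup G] [Module ℂ G] [UniformSpace G]
    {ι : Type*} [Nonempty ι] {s : SeminormFamily ℂ G ι} (hs : WithSeminorms s)
    (b : C →ₗ[ℂ] ProjTensor E F →ₗ[ℂ] G)
    (h : ∀ i, ∃ (m : Seminorm ℂ C) (p : Seminorm ℂ E) (q : Seminorm ℂ F),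
      Continuous m ∧ Continuous p ∧ Continuous q ∧
      ∀ c x y, s i (b c (tmul x y)) ≤ m c * (p x * q y)) :
    Continuous fun z : C × ProjTensor E F => b z.1 z.2 := by
  refine continuous_of_seminorm_bound hs b fun i => ?_
  obtain ⟨m, p, q, hm, hp, hq, hb⟩ := h i
  obtain ⟨P, hP, hmax⟩ := exists_seminorm p q
  refine ⟨m, P, hm, (withSeminorms E F).continuous_seminorm ⟨P, p, q, hp, hq, hP⟩, fun c t => ?_⟩
  have key : ∀ ε : ℝ, 0 < ε → s i (b c t) ≤ (m c + ε) * P t := by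
    intro ε hε
    have h1 : 0 < m c + ε := add_pos_of_nonneg_of_pos (apply_nonneg m c) hε
    have := hmax ((s i).comp ((((m c + ε)⁻¹ : ℝ) : ℂ) • b c)) (fun x y => by
      rw [Seminorm.comp_apply, LinearMap.smul_apply, map_smul_eq_mul, Complex.norm_real,
        Real.norm_of_nonneg (by positivity), inv_mul_le_iff₀ h1]
      refine (hb c x y).trans (mul_le_mul_of_nonneg_right (by linarith)
        (mul_nonneg (apply_nonneg p x) (apply_nonneg q y)))) t
    rwa [Seminorm.comp_apply, LinearMap.smul_apply, map_smul_eq_mul, Complex.norm_real,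
        Real.norm_of_nonneg (by positivity), inv_mul_le_iff₀ h1] at this
  have hlim : Filter.Tendsto (fun ε : ℝ => (m c + ε) * P t) (𝓝[>] 0) (𝓝 ((m c + 0) * P t)) :=
    Filter.Tendsto.mono_left (Continuous.tendsto (by fun_prop) 0) nhdsWithin_le_nhds
  rw [add_zero] at hlim
  exact ge_of_tendsto hlim (Filter.eventually_of_mem self_mem_nhdsWithin key)

/-- A linear map on the projective tensor product is continuous as soon as the corresponding
bilinear map is. -/
theorem continuous_lift [IsLCS E] [IsLCS F] {G : Type*} [AddCommGroup G] [Module ℂ G]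
    [UniformSpace G] [IsLCS G] (φ : ProjTensor E F →ₗ[ℂ] G)
    (h : Continuous fun z : E × F => φ (tmul z.1 z.2)) : Continuous φ := by
  have := IsLCS.polynormable (E := G)
  refine (PolynormableSpace.withSeminorms ℂ G).continuous_of_continuous_comp φ fun r => ?_
  exact (withSeminorms E F).continuous_seminorm
    ⟨r.1.comp φ, IsLCS.exists_bound (tmul.compr₂ φ) h r.2⟩

/-- The linear map `φ ⊗ ψ`. -/
noncomputable def mapₗ {E' F' : Type u} [AddCommGroup E'] [Module ℂ E'] [AddCommGroup F']
    [Module ℂ F'] (φ : E →ₗ[ℂ] E') (ψ : F →ₗ[ℂ] F') : ProjTensor E F →ₗ[ℂ] ProjTensor E' F' :=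
  TensorProduct.map φ ψ

/-- The continuous linear map `φ ⊗ ψ`. -/
noncomputable def map {E' F' : Type u} [AddCommGroup E'] [Module ℂ E'] [UniformSpace E']
    [AddCommGroup F'] [Module ℂ F'] [UniformSpace F'] [IsLCS E] [IsLCS F] [IsLCS E'] [IsLCS F']
    (φ : E →L[ℂ] E') (ψ : F →L[ℂ] F') : ProjTensor E F →L[ℂ] ProjTensor E' F' where
  toLinearMap := mapₗ φ ψ
  cont := continuous_lift (mapₗ (φ : E →ₗ[ℂ] E') (ψ : F →ₗ[ℂ] F'))
    (continuous_tmul.comp (φ.continuous.prodMap ψ.continuous))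

theorem map_tmul {E' F' : Type u} [AddCommGroup E'] [Module ℂ E'] [UniformSpace E']
    [AddCommGroup F'] [Module ℂ F'] [UniformSpace F'] [IsLCS E] [IsLCS F] [IsLCS E'] [IsLCS F']
    (φ : E →L[ℂ] E') (ψ : F →L[ℂ] F') (x : E) (y : F) :
    map φ ψ (tmul x y) = tmul (φ x) (ψ y) := rfl

end ProjTensor
end ProjTensor

/-! ### Bimodules -/

section Bimodules

/-- Locally convex `A`-`B`-bimodules with jointly continuous actions (not necessarily Hausdorff or
complete); a right action of `B` is an action of `Bᵐᵒᵖ`. -/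
structure LCBimodule (A B : Type u) [Ring A] [Algebra ℂ A] [UniformSpace A]
    [Ring B] [Algebra ℂ B] [UniformSpace B] where
  carrier : Type u
  [addCommGroup : AddCommGroup carrier]
  [module : Module ℂ carrier]
  [uniformSpace : UniformSpace carrier]
  [isLCS : IsLCS carrier]
  [leftModule : Module A carrier]
  [rightModule : Module Bᵐᵒᵖ carrier]
  [smulCommClass : SMulCommClass A Bᵐᵒᵖ carrier]
  [left_isScalarTower : IsScalarTower ℂ A carrier]
  [right_isScalarTower : IsScalarTower ℂ Bᵐᵒᵖ carrier]
  [left_continuousSMul : ContinuousSMul A carrier]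
  [right_continuousSMul : ContinuousSMul Bᵐᵒᵖ carrier]

attribute [instance] LCBimodule.addCommGroup LCBimodule.module LCBimodule.uniformSpace
  LCBimodule.isLCS LCBimodule.leftModule LCBimodule.rightModule LCBimodule.smulCommClass
  LCBimodule.left_isScalarTower LCBimodule.right_isScalarTower
  LCBimodule.left_continuousSMul LCBimodule.right_continuousSMul

/-- `A`-`B`-`⊗̂`-bimodules: the complete Hausdorff ones. -/
structure HatBimodule (A B : Type u) [Ring A] [Algebra ℂ A] [UniformSpace A]
    [Ring B] [Algebra ℂ B] [UniformSpace B] extends LCBimodule A B where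
  [completeSpace : CompleteSpace carrier]
  [t2Space : T2Space carrier]

attribute [instance] HatBimodule.completeSpace HatBimodule.t2Space

variable {A B C D : Type u}
  [Ring A] [Algebra ℂ A] [UniformSpace A] [Ring B] [Algebra ℂ B] [UniformSpace B]
  [Ring C] [Algebra ℂ C] [UniformSpace C] [Ring D] [Algebra ℂ D] [UniformSpace D]

instance : CoeSort (LCBimodule A B) (Type u) := ⟨LCBimodule.carrier⟩
instance : CoeSort (HatBimodule A B) (Type u) := ⟨fun X => X.carrier⟩

/-- Bimodule morphisms: continuous linear maps compatible with both actions. -/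
structure LCBimodule.Hom (X Y : LCBimodule A B) extends X →L[ℂ] Y where
  map_left' : ∀ (a : A) (x : X), toFun (a • x) = a • toFun x
  map_right' : ∀ (b : Bᵐᵒᵖ) (x : X), toFun (b • x) = b • toFun x

namespace LCBimodule

instance (X Y : LCBimodule A B) : FunLike (Hom X Y) X Y where
  coe φ := φ.toFun
  coe_injective φ ψ h := by
    cases φ; cases ψ; congr; exact DFunLike.coe_injective h

variable {X Y : LCBimodule A B}

theorem Hom.map_left (φ : Hom X Y) (a : A) (x : X) : φ (a • x) = a • φ x := φ.map_left' a x
theorem Hom.map_right (φ : Hom X Y) (b : Bᵐᵒᵖ) (x : X) : φ (b • x) = b • φ x := φ.map_right' b x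
theorem Hom.coe_toCLM (φ : Hom X Y) (x : X) : φ.toContinuousLinearMap x = φ x := rfl

instance (X : LCBimodule A B) : UniformContinuousConstSMul A X :=
  uniformContinuousConstSMul_of_continuousConstSMul _ _
instance (X : LCBimodule A B) : UniformContinuousConstSMul Bᵐᵒᵖ X :=
  uniformContinuousConstSMul_of_continuousConstSMul _ _
instance (X : LCBimodule A B) : UniformContinuousConstSMul ℂ X :=
  uniformContinuousConstSMul_of_continuousConstSMul _ _

end LCBimodule

section Completion

variable {E : Type*} [AddCommGroup E] [Module ℂ E] [UniformSpace E] [IsLCS E]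

theorem completion_continuousSMul {C E : Type*} [Ring C] [TopologicalSpace C]
    [IsTopologicalAddGroup C] [AddCommGroup E] [UniformSpace E] [IsUniformAddGroup E]
    [Module C E] [ContinuousSMul C E] [UniformContinuousConstSMul C E] :
    ContinuousSMul C (Completion E) := by
  let b : C →+ E →+ Completion E :=
    (AddMonoidHom.smul : C →+ E →+ E).compr₂ UniformSpace.Completion.toCompl
  have hb : Continuous fun p : C × E => b p.1 p.2 :=
    (UniformSpace.Completion.continuous_coe E).comp continuous_smul
  have d1 : IsDenseInducing (AddMonoidHom.id C) := ⟨Topology.IsInducing.id, denseRange_id⟩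
  have d2 : IsDenseInducing (UniformSpace.Completion.toCompl : E → Completion E) :=
    UniformSpace.Completion.isDenseInducing_coe
  have hc := d1.extend_Z_bilin d2 hb
  refine ⟨hc.congr ?_⟩
  rintro ⟨c, x⟩
  induction x using UniformSpace.Completion.induction_on with
  | hp => exact isClosed_eq (hc.comp (Continuous.prodMk_right c)) (continuous_const_smul c)
  | ih x =>
    rw [← UniformSpace.Completion.coe_smul]
    exact (d1.prodMap d2).extend_eq hb (c, x)

theorem completion_map_smul {C E F : Type*} [Ring C]
    [AddCommGroup E] [UniformSpace E] [IsUniformAddGroup E] [Module ℂ E]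
    [UniformContinuousConstSMul ℂ E] [Module C E] [UniformContinuousConstSMul C E]
    [AddCommGroup F] [UniformSpace F] [IsUniformAddGroup F] [Module ℂ F]
    [UniformContinuousConstSMul ℂ F] [Module C F] [UniformContinuousConstSMul C F]
    (φ : E →L[ℂ] F) (h : ∀ (c : C) (x : E), φ (c • x) = c • φ x) (c : C) (x : Completion E) :
    φ.completion (c • x) = c • φ.completion x := by
  induction x using UniformSpace.Completion.induction_on with
  | hp =>
    exact isClosed_eq (φ.completion.continuous.comp (continuous_const_smul c))
      ((continuous_const_smul c).comp φ.completion.continuous)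
  | ih x =>
    rw [← UniformSpace.Completion.coe_smul, ContinuousLinearMap.completion_apply_coe,
      ContinuousLinearMap.completion_apply_coe, ← UniformSpace.Completion.coe_smul, h]

theorem completion_isLCS [UniformContinuousConstSMul ℂ E] : IsCompleteLCS (Completion E) := by
  have : ContinuousSMul ℂ (Completion E) := completion_continuousSMul
  have : LocallyConvexSpace ℝ (Completion E) := by
    rw [locallyConvexSpace_iff_exists_convex_subset_zero]
    intro U hU
    obtain ⟨V, hV, hVc, hVU⟩ := exists_mem_nhds_isClosed_subset hU
    have h1 : ((↑) : E → Completion E) ⁻¹' V ∈ 𝓝 (0 : E) :=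
      (UniformSpace.Completion.continuous_coe E).continuousAt.preimage_mem_nhds
        (by rwa [UniformSpace.Completion.coe_zero])
    obtain ⟨W, hW, hWc, hWV⟩ := (locallyConvexSpace_iff_exists_convex_subset_zero ℝ E).1
      inferInstance _ h1
    refine ⟨closure ((↑) '' W), ?_, ?_, ?_⟩
    · have := UniformSpace.Completion.isDenseInducing_coe.closure_image_mem_nhds hW
      rwa [UniformSpace.Completion.coe_zero] at this
    · have : ContinuousSMul ℝ (Completion E) := IsScalarTower.continuousSMul ℂ
      refine Convex.closure ?_
      rintro _ ⟨x, hx, rfl⟩ _ ⟨y, hy, rfl⟩ a b ha hb hab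
      refine ⟨a • x + b • y, hWc hx hy ha hb hab, ?_⟩
      rw [UniformSpace.Completion.coe_add]
      congr 1 <;> exact UniformSpace.Completion.coe_smul (M := ℂ) _ _
    · exact closure_minimal (Set.image_subset_iff.2 hWV) hVc |>.trans hVU
  exact {}

end Completion

namespace LCBimodule

/-- The bimodule given by a space with two commuting, jointly continuous actions. -/
noncomputable def ofActions (E : Type u) [AddCommGroup E] [Module ℂ E] [UniformSpace E]
    [IsLCS E]
    (L : A →ₐ[ℂ] Module.End ℂ E) (R : Bᵐᵒᵖ →ₐ[ℂ] Module.End ℂ E)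
    (hLR : ∀ a b t, L a (R b t) = R b (L a t))
    (hL : Continuous fun z : A × E => L z.1 z.2)
    (hR : Continuous fun z : B × E => R (MulOpposite.op z.1) z.2) : LCBimodule A B :=
  letI : Module A E := Module.compHom _ L.toRingHom
  letI : Module Bᵐᵒᵖ E := Module.compHom _ R.toRingHom
  { carrier := E
    smulCommClass := ⟨hLR⟩
    left_isScalarTower := ⟨fun z a t => congrArg (fun φ : Module.End ℂ _ => φ t) (map_smul L z a)⟩
    right_isScalarTower := ⟨fun z d t => congrArg (fun φ : Module.End ℂ _ => φ t) (map_smul R z d)⟩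
    left_continuousSMul := ⟨hL⟩
    right_continuousSMul := ⟨hR.comp
      ((MulOpposite.continuous_unop.comp continuous_fst).prodMk continuous_snd)⟩ }

/-- The (Hausdorff) completion of a locally convex bimodule. -/
noncomputable def completion [IsTopologicalAddGroup A] [IsTopologicalAddGroup B]
    (X : LCBimodule A B) : HatBimodule A B :=
  letI := completion_isLCS (E := X)
  have : IsTopologicalAddGroup Bᵐᵒᵖ := { }
  { carrier := Completion X
    isLCS := inferInstance
    left_continuousSMul := completion_continuousSMul
    right_continuousSMul := completion_continuousSMul }

/-- The extension of a bimodule morphism to the completions. -/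
noncomputable def Hom.completion [IsTopologicalAddGroup A] [IsTopologicalAddGroup B]
    {X Y : LCBimodule A B} (φ : Hom X Y) :
    Hom X.completion.toLCBimodule Y.completion.toLCBimodule where
  toContinuousLinearMap :=
    (φ.toContinuousLinearMap.completion : Completion X →L[ℂ] Completion Y)
  map_left' := completion_map_smul φ.toContinuousLinearMap φ.map_left
  map_right' := completion_map_smul φ.toContinuousLinearMap φ.map_right

/-- Subspaces stable under both actions. -/
structure IsSubbimodule (X : LCBimodule A B) (N : Submodule ℂ X) : Prop where
  left : ∀ (a : A), ∀ x ∈ N, a • x ∈ N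
  right : ∀ (b : Bᵐᵒᵖ), ∀ x ∈ N, b • x ∈ N

section Quotient

variable (X : LCBimodule A B) (N : Submodule ℂ X)

/-- The action induced on a quotient. -/
def quotientAction {C : Type*} [Ring C] [Algebra ℂ C] [Module C X] [IsScalarTower ℂ C X]
    (h : ∀ (c : C), ∀ x ∈ N, c • x ∈ N) : C →+* Module.End ℂ (X ⧸ N) where
  toFun c := N.mapQ N (Algebra.lsmul ℂ ℂ X c) (fun x hx => h c x hx)
  map_one' := by ext; simp
  map_zero' := by ext; simp
  map_add' a b := by
    ext x
    exact congrArg N.mkQ (add_smul a b x)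
  map_mul' a b := by
    ext x
    exact congrArg N.mkQ (mul_smul a b x)

theorem quotient_isLCS : @IsLCS (X ⧸ N) _ _ (IsTopologicalAddGroup.rightUniformSpace (X ⧸ N)) := by
  let : UniformSpace (X ⧸ N) := IsTopologicalAddGroup.rightUniformSpace (X ⧸ N)
  have : LocallyConvexSpace ℝ (X ⧸ N) := by
    rw [locallyConvexSpace_iff_exists_convex_subset_zero]
    intro U hU
    have h1 : N.mkQ ⁻¹' U ∈ 𝓝 (0 : X) :=
      N.continuous_mkQ.continuousAt.preimage_mem_nhds (by rwa [map_zero])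
    obtain ⟨W, hW, hWc, hWV⟩ := (locallyConvexSpace_iff_exists_convex_subset_zero ℝ X).1
      inferInstance _ h1
    refine ⟨N.mkQ '' W, ?_, ?_, Set.image_subset_iff.2 hWV⟩
    · have := N.isOpenMap_mkQ.image_mem_nhds hW
      rwa [map_zero] at this
    · rintro _ ⟨x, hx, rfl⟩ _ ⟨y, hy, rfl⟩ a b ha hb hab
      exact ⟨a • x + b • y, hWc hx hy ha hb hab, rfl⟩
  exact { isUniformAddGroup_of_addCommGroup with }

variable {X N}

/-- The quotient bimodule, with the quotient topology. -/
noncomputable def quotient (hN : X.IsSubbimodule N) : LCBimodule A B :=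
  letI : UniformSpace (X ⧸ N) := IsTopologicalAddGroup.rightUniformSpace (X ⧸ N)
  letI : Module A (X ⧸ N) := Module.compHom _ (quotientAction X N hN.left)
  letI : Module Bᵐᵒᵖ (X ⧸ N) := Module.compHom _ (quotientAction X N hN.right)
  have h1 (a : A) (x : X) : a • N.mkQ x = N.mkQ (a • x) := rfl
  have h2 (b : Bᵐᵒᵖ) (x : X) : b • N.mkQ x = N.mkQ (b • x) := rfl
  { carrier := X ⧸ N
    isLCS := quotient_isLCS X N
    smulCommClass := ⟨fun a b x => by
      obtain ⟨x, rfl⟩ := N.mkQ_surjective x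
      simp only [h1, h2, smul_comm a b x]⟩
    left_isScalarTower := ⟨fun z a x => by
      obtain ⟨x, rfl⟩ := N.mkQ_surjective x
      rw [h1, h1, smul_assoc, map_smul]⟩
    right_isScalarTower := ⟨fun z a x => by
      obtain ⟨x, rfl⟩ := N.mkQ_surjective x
      rw [h2, h2, smul_assoc, map_smul]⟩
    left_continuousSMul := ⟨by
      rw [← (IsOpenQuotientMap.id.prodMap N.isOpenQuotientMap_mkQ).continuous_comp_iff]
      exact N.continuous_mkQ.comp continuous_smul⟩
    right_continuousSMul := ⟨by
      rw [← (IsOpenQuotientMap.id.prodMap N.isOpenQuotientMap_mkQ).continuous_comp_iff]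
      exact N.continuous_mkQ.comp continuous_smul⟩ }

/-- The morphism induced on quotients. -/
noncomputable def Hom.quotient {X Y : LCBimodule A B} {N : Submodule ℂ X} {M : Submodule ℂ Y}
    (φ : Hom X Y) (hN : X.IsSubbimodule N) (hM : Y.IsSubbimodule M)
    (h : ∀ x ∈ N, φ x ∈ M) : Hom (LCBimodule.quotient hN) (LCBimodule.quotient hM) where
  toFun := N.mapQ M φ.toLinearMap h
  map_add' := map_add _
  map_smul' := map_smul _
  cont := by
    have : Continuous (N.mapQ M φ.toLinearMap h) := by
      rw [N.isQuotientMap_mkQ.continuous_iff]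
      exact M.continuous_mkQ.comp φ.cont
    exact this
  map_left' a x := by
    obtain ⟨x, rfl⟩ := N.mkQ_surjective x
    exact congrArg M.mkQ (φ.map_left a x)
  map_right' a x := by
    obtain ⟨x, rfl⟩ := N.mkQ_surjective x
    exact congrArg M.mkQ (φ.map_right a x)

end Quotient

section Proj

/-- The left action on `X ⊗ Y`, from that on `X`. -/
noncomputable def projLeft (X : LCBimodule A B) (Y : LCBimodule C D) :
    A →ₐ[ℂ] Module.End ℂ (ProjTensor X Y) :=
  (Module.End.rTensorAlgHom ℂ X Y).comp (Algebra.lsmul ℂ ℂ X)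

/-- The right action on `X ⊗ Y`, from that on `Y`. -/
noncomputable def projRight (X : LCBimodule A B) (Y : LCBimodule C D) :
    Dᵐᵒᵖ →ₐ[ℂ] Module.End ℂ (ProjTensor X Y) :=
  (Module.End.lTensorAlgHom ℂ Y X).comp (Algebra.lsmul ℂ ℂ Y)

theorem projLeft_tmul (X : LCBimodule A B) (Y : LCBimodule C D) (a : A) (x : X) (y : Y) :
    projLeft X Y a (ProjTensor.tmul x y) = ProjTensor.tmul (a • x) y := rfl

theorem projRight_tmul (X : LCBimodule A B) (Y : LCBimodule C D) (d : Dᵐᵒᵖ) (x : X) (y : Y) :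
    projRight X Y d (ProjTensor.tmul x y) = ProjTensor.tmul x (d • y) := rfl

theorem projLeft_projRight (X : LCBimodule A B) (Y : LCBimodule C D) (a : A) (d : Dᵐᵒᵖ)
    (t : ProjTensor X Y) :
    projLeft X Y a (projRight X Y d t) = projRight X Y d (projLeft X Y a t) := by
  induction t using ProjTensor.induction_on with
  | tmul x y => simp only [projLeft_tmul, projRight_tmul]
  | add s t hs ht => simp only [map_add, hs, ht]

theorem continuous_projLeft [IsLCS A] (X : LCBimodule A B) (Y : LCBimodule C D) :
    Continuous fun z : A × ProjTensor X Y => projLeft X Y z.1 z.2 := by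
  refine ProjTensor.continuous_bilinear (ProjTensor.withSeminorms X Y)
    (projLeft X Y).toLinearMap ?_
  rintro ⟨r, p, q, hp, hq, hr⟩
  obtain ⟨m, p', hm, hp', h⟩ := IsLCS.exists_bound
    (Algebra.lsmul ℂ ℂ (X : Type u) : A →ₐ[ℂ] _).toLinearMap continuous_smul hp
  refine ⟨m, p', q, hm, hp', hq, fun a x y => (hr (a • x) y).trans ?_⟩
  rw [← mul_assoc]
  exact mul_le_mul_of_nonneg_right (h a x) (apply_nonneg q y)

theorem continuous_projRight [IsLCS D] (X : LCBimodule A B) (Y : LCBimodule C D) :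
    Continuous fun z : D × ProjTensor X Y => projRight X Y (MulOpposite.op z.1) z.2 := by
  refine ProjTensor.continuous_bilinear (ProjTensor.withSeminorms X Y)
    ((projRight X Y).toLinearMap ∘ₗ (MulOpposite.opLinearEquiv ℂ).toLinearMap) ?_
  rintro ⟨r, p, q, hp, hq, hr⟩
  obtain ⟨m, q', hm, hq', h⟩ := IsLCS.exists_bound
    ((Algebra.lsmul ℂ ℂ (Y : Type u) : Dᵐᵒᵖ →ₐ[ℂ] _).toLinearMap ∘ₗ
      (MulOpposite.opLinearEquiv ℂ).toLinearMap)
    (continuous_smul.comp ((MulOpposite.continuous_op.comp continuous_fst).prodMk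
      continuous_snd)) hq
  refine ⟨m, p, q', hm, hp, hq', fun d x y => (hr x (MulOpposite.op d • y)).trans ?_⟩
  rw [mul_left_comm]
  exact mul_le_mul_of_nonneg_left (h d y) (apply_nonneg p x)

/-- `X ⊗ Y` with the projective topology as a bimodule. -/
noncomputable def projTensor [IsLCS A] [IsLCS D] (X : LCBimodule A B) (Y : LCBimodule C D) :
    LCBimodule A D :=
  ofActions (ProjTensor X Y) (projLeft X Y) (projRight X Y) (projLeft_projRight X Y)
    (continuous_projLeft X Y) (continuous_projRight X Y)

theorem projMap_left {X X' : LCBimodule A B} {Y Y' : LCBimodule C D}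
    (φ : Hom X X') (ψ : Hom Y Y') (a : A) (t : ProjTensor X Y) :
    ProjTensor.map φ.toContinuousLinearMap ψ.toContinuousLinearMap (projLeft X Y a t) =
      projLeft X' Y' a (ProjTensor.map φ.toContinuousLinearMap ψ.toContinuousLinearMap t) := by
  induction t using ProjTensor.induction_on with
  | tmul x y =>
    rw [projLeft_tmul, ProjTensor.map_tmul, ProjTensor.map_tmul, projLeft_tmul]
    exact congrArg (fun z => ProjTensor.tmul z (ψ y)) (φ.map_left a x)
  | add s t hs ht => simp only [map_add, hs, ht]

theorem projMap_right {X X' : LCBimodule A B} {Y Y' : LCBimodule C D}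
    (φ : Hom X X') (ψ : Hom Y Y') (d : Dᵐᵒᵖ) (t : ProjTensor X Y) :
    ProjTensor.map φ.toContinuousLinearMap ψ.toContinuousLinearMap (projRight X Y d t) =
      projRight X' Y' d (ProjTensor.map φ.toContinuousLinearMap ψ.toContinuousLinearMap t) := by
  induction t using ProjTensor.induction_on with
  | tmul x y =>
    rw [projRight_tmul, ProjTensor.map_tmul, ProjTensor.map_tmul, projRight_tmul]
    exact congrArg (fun z => ProjTensor.tmul (φ x) z) (ψ.map_right d y)
  | add s t hs ht => simp only [map_add, hs, ht]

/-- The bimodule morphism `φ ⊗ ψ`. -/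
noncomputable def Hom.projTensor [IsLCS A] [IsLCS D] {X X' : LCBimodule A B} {Y Y' : LCBimodule C D}
    (φ : Hom X X') (ψ : Hom Y Y') : Hom (X.projTensor Y) (X'.projTensor Y') where
  toContinuousLinearMap :=
    (ProjTensor.map φ.toContinuousLinearMap ψ.toContinuousLinearMap :
      ProjTensor X Y →L[ℂ] ProjTensor X' Y')
  map_left' := projMap_left φ ψ
  map_right' := projMap_right φ ψ

end Proj

end LCBimodule

namespace HatBimodule

/-- Morphisms of `⊗̂`-bimodules. -/
abbrev Hom (X Y : HatBimodule A B) := LCBimodule.Hom X.toLCBimodule Y.toLCBimodule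

section Tensor

variable [IsLCS A] [IsLCS C]

/-- The complete projective tensor product `X ⊗̂ Y`, as an `A`-`C`-`⊗̂`-bimodule. -/
noncomputable def tensor (X : HatBimodule A B) (Y : HatBimodule B C) : HatBimodule A C :=
  (X.toLCBimodule.projTensor Y.toLCBimodule).completion

/-- The elementary tensor `x ⊗ y` in `X ⊗̂ Y`. -/
noncomputable def tmul (X : HatBimodule A B) (Y : HatBimodule B C) (x : X) (y : Y) : tensor X Y :=
  show Completion (ProjTensor X Y) from ((ProjTensor.tmul x y : ProjTensor X Y))

theorem smul_tmul (X : HatBimodule A B) (Y : HatBimodule B C) (a : A) (x : X) (y : Y) :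
    a • tmul X Y x y = tmul X Y (a • x) y :=
  (UniformSpace.Completion.coe_smul (X := X.toLCBimodule.projTensor Y.toLCBimodule) a
    (ProjTensor.tmul x y : ProjTensor X Y)).symm

theorem op_smul_tmul (X : HatBimodule A B) (Y : HatBimodule B C) (c : Cᵐᵒᵖ) (x : X) (y : Y) :
    c • tmul X Y x y = tmul X Y x (c • y) :=
  (UniformSpace.Completion.coe_smul (X := X.toLCBimodule.projTensor Y.toLCBimodule) c
    (ProjTensor.tmul x y : ProjTensor X Y)).symm

/-- `φ ⊗̂ ψ : X ⊗̂ Y → X' ⊗̂ Y'`. -/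
noncomputable def tensorMap {X X' : HatBimodule A B} {Y Y' : HatBimodule B C}
    (φ : Hom X X') (ψ : Hom Y Y') : Hom (tensor X Y) (tensor X' Y') :=
  (LCBimodule.Hom.projTensor φ ψ).completion

theorem tensorMap_tmul {X X' : HatBimodule A B} {Y Y' : HatBimodule B C}
    (φ : Hom X X') (ψ : Hom Y Y') (x : X) (y : Y) :
    tensorMap φ ψ (tmul X Y x y) = tmul X' Y' (φ x) (ψ y) :=
  ContinuousLinearMap.completion_apply_coe
    (LCBimodule.Hom.projTensor φ ψ).toContinuousLinearMap (ProjTensor.tmul x y : ProjTensor X Y)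

/-- The elements `x·b ⊗ y - x ⊗ b·y` of `X ⊗̂ Y`. -/
def relators (X : HatBimodule A B) (Y : HatBimodule B C) : Set (tensor X Y) :=
  {t | ∃ (x : X) (b : B) (y : Y),
    t = tmul X Y (MulOpposite.op b • x) y - tmul X Y x (b • y)}

/-- The closure of the linear span of the elements `x·b ⊗ y - x ⊗ b·y` in `X ⊗̂ Y`. -/
noncomputable def balancedRel (X : HatBimodule A B) (Y : HatBimodule B C) :
    Submodule ℂ (tensor X Y) :=
  (Submodule.span ℂ (relators X Y)).topologicalClosure

theorem mem_balancedRel_of_mapsTo {X X' : HatBimodule A B} {Y Y' : HatBimodule B C}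
    (φ : tensor X Y →L[ℂ] tensor X' Y') (h : Set.MapsTo φ (relators X Y) (relators X' Y')) :
    ∀ t ∈ balancedRel X Y, φ t ∈ balancedRel X' Y' := by
  intro t ht
  refine map_mem_closure φ.continuous ht fun s hs => ?_
  have : Submodule.span ℂ (relators X Y) ≤
      (Submodule.span ℂ (relators X' Y')).comap (φ : tensor X Y →ₗ[ℂ] tensor X' Y') :=
    Submodule.span_le.2 fun r hr => Submodule.subset_span (h hr)
  exact this hs

theorem isSubbimodule_balancedRel (X : HatBimodule A B) (Y : HatBimodule B C) :
    (tensor X Y).IsSubbimodule (balancedRel X Y) where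
  left a := by
    refine mem_balancedRel_of_mapsTo (⟨Algebra.lsmul ℂ ℂ (tensor X Y : Type u) a,
      continuous_const_smul a⟩ : tensor X Y →L[ℂ] tensor X Y) ?_
    rintro _ ⟨x, b, y, rfl⟩
    refine ⟨a • x, b, y, (smul_sub a (tmul X Y _ y) (tmul X Y x _)).trans ?_⟩
    rw [smul_tmul, smul_tmul, smul_comm]
  right c := by
    refine mem_balancedRel_of_mapsTo (⟨Algebra.lsmul ℂ ℂ (tensor X Y : Type u) c,
      continuous_const_smul c⟩ : tensor X Y →L[ℂ] tensor X Y) ?_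
    rintro _ ⟨x, b, y, rfl⟩
    refine ⟨x, b, c • y, (smul_sub c (tmul X Y _ y) (tmul X Y x _)).trans ?_⟩
    rw [op_smul_tmul, op_smul_tmul, smul_comm b c y]

theorem tensorMap_balancedRel {X X' : HatBimodule A B} {Y Y' : HatBimodule B C}
    (φ : Hom X X') (ψ : Hom Y Y') : ∀ t ∈ balancedRel X Y, tensorMap φ ψ t ∈ balancedRel X' Y' := by
  refine mem_balancedRel_of_mapsTo (tensorMap φ ψ).toContinuousLinearMap ?_
  rintro _ ⟨x, b, y, rfl⟩
  refine ⟨φ x, b, ψ y, ?_⟩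
  refine (map_sub (tensorMap φ ψ).toContinuousLinearMap _ _).trans ?_
  exact congrArg₂ (· - ·)
    ((tensorMap_tmul φ ψ _ _).trans (congrArg (tmul X' Y' · _) (φ.map_right _ x)))
    ((tensorMap_tmul φ ψ _ _).trans (congrArg (tmul X' Y' _ ·) (ψ.map_left _ y)))

/-- The projective `B`-module tensor product `X ⊗̂_B Y`: the completion of the quotient of `X ⊗̂ Y`
by the closed linear span of the elements `x·b ⊗ y - x ⊗ b·y`. -/
noncomputable def balancedTensor (X : HatBimodule A B) (Y : HatBimodule B C) : HatBimodule A C :=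
  (LCBimodule.quotient (isSubbimodule_balancedRel X Y)).completion

/-- `φ ⊗̂_B ψ : X ⊗̂_B Y → X' ⊗̂_B Y'`. -/
noncomputable def balancedMap {X X' : HatBimodule A B} {Y Y' : HatBimodule B C}
    (φ : Hom X X') (ψ : Hom Y Y') : Hom (balancedTensor X Y) (balancedTensor X' Y') :=
  ((tensorMap φ ψ).quotient (isSubbimodule_balancedRel X Y) (isSubbimodule_balancedRel X' Y')
    (tensorMap_balancedRel φ ψ)).completion

end Tensor

end HatBimodule
end Bimodules

section Homological

variable {A B C D R S : Type u}
  [Ring A] [Algebra ℂ A] [UniformSpace A] [IsTensorHatAlgebra A]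
  [Ring B] [Algebra ℂ B] [UniformSpace B] [IsTensorHatAlgebra B]
  [Ring C] [Algebra ℂ C] [UniformSpace C] [IsTensorHatAlgebra C]
  [Ring D] [Algebra ℂ D] [UniformSpace D] [IsTensorHatAlgebra D]
  [Ring R] [Algebra ℂ R] [UniformSpace R] [IsTensorHatAlgebra R]
  [Ring S] [Algebra ℂ S] [UniformSpace S] [IsTensorHatAlgebra S]

/-- The `A`-`⊗̂`-bimodule `A`. -/
def HatBimodule.regular (A : Type u) [Ring A] [Algebra ℂ A] [UniformSpace A]
    [IsTensorHatAlgebra A] : HatBimodule A A where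
  carrier := A

/-- Restriction of scalars along `f : A → B` on the left and `g : C → D` on the right. -/
noncomputable def HatBimodule.restrict (f : A →A[ℂ] B) (g : C →A[ℂ] D) (X : HatBimodule B D) :
    HatBimodule A C where
  toLCBimodule := LCBimodule.ofActions X
    ((Algebra.lsmul ℂ ℂ (X : Type u)).comp f.toAlgHom)
    ((Algebra.lsmul ℂ ℂ (X : Type u)).comp g.toAlgHom.op)
    (fun a c x => smul_comm (f a) (MulOpposite.op (g c.unop)) x)
    (continuous_smul.comp ((f.cont.comp continuous_fst).prodMk continuous_snd))
    (continuous_smul.comp ((MulOpposite.continuous_op.comp (g.cont.comp continuous_fst)).prodMk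
      continuous_snd))
  completeSpace := X.completeSpace
  t2Space := X.t2Space

/-- An `R`-`⊗̂`-algebra is a `⊗̂`-algebra `A` with a homomorphism `ηA : R → A`. Given an
`R`-`⊗̂`-algebra `(A, ηA)` and an `S`-`⊗̂`-algebra `(B, ηB)`, the pair `(f, g)` is an
`R`-`S`-homomorphism if the square formed by `f`, `g`, `ηA`, `ηB` commutes. -/
def IsRSHomomorphism (ηA : R →A[ℂ] A) (ηB : S →A[ℂ] B) (f : A →A[ℂ] B) (g : R →A[ℂ] S) : Prop :=
  f.comp ηA = ηB.comp g

/-- Epimorphisms in the category of `⊗̂`-algebras. -/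
def IsHatEpimorphism (f : A →A[ℂ] B) : Prop :=
  ∀ (C : Type u) [Ring C] [Algebra ℂ C] [UniformSpace C] [IsTensorHatAlgebra C]
    (φ ψ : B →A[ℂ] C), φ.comp f = ψ.comp f → φ = ψ

/-! ### Derivations and Property (UDE) -/

/-- The space `Der(A, X)` of continuous derivations from `A` to the `B`-`⊗̂`-bimodule `X`, regarded
as an `A`-bimodule along `f : A → B`. -/
def Der (f : A →A[ℂ] B) (X : HatBimodule B B) : Submodule ℂ (A →L[ℂ] X) where
  carrier := {D | ∀ a b : A, D (a * b) = f a • D b + MulOpposite.op (f b) • D a}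
  zero_mem' a b := by simp
  add_mem' {D E} hD hE a b := by
    simp only [add_apply, hD a b, hE a b, smul_add]
    abel
  smul_mem' z D hD a b := by
    simp only [smul_apply, hD a b, smul_add, smul_comm z]

/-- The map `Der(B, X) → Der(A, X)`, `D ↦ D ∘ f`. -/
def Der.comp (f : A →A[ℂ] B) (X : HatBimodule B B) (D : Der (ContinuousAlgHom.id ℂ B) X) :
    Der f X :=
  ⟨D.1.comp f.toContinuousLinearMap, fun a b => by
    have := D.2 (f a) (f b)
    simpa [map_mul] using this⟩

/-- Property (UDE): the unique extension property for derivations. -/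
def PropertyUDE (f : A →A[ℂ] B) : Prop :=
  ∀ X : HatBimodule B B, Function.Bijective (Der.comp f X)

/-! ### Relatively quasi-free algebras -/

/-- `A` is relatively quasi-free over `R`: every admissible singular `R`-extension of `A` splits.
Such an extension is a surjective homomorphism of `R`-`⊗̂`-algebras `σ : E → A` with
`(ker σ)² = 0`; it is admissible if `σ` has a right inverse which is an `R`-`⊗̂`-bimodule morphism,
and split if `σ` has a right inverse which is a homomorphism of `R`-`⊗̂`-algebras. -/
def IsRelativelyQuasiFree (ηA : R →A[ℂ] A) : Prop :=
  ∀ (E : Type u) [Ring E] [Algebra ℂ E] [UniformSpace E] [IsTensorHatAlgebra E]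
    (ηE : R →A[ℂ] E) (σ : E →A[ℂ] A),
    σ.comp ηE = ηA →
    (∀ x y : E, σ x = 0 → σ y = 0 → x * y = 0) →
    (∃ s : A →L[ℂ] E, (∀ a, σ (s a) = a) ∧ (∀ r a, s (ηA r * a) = ηE r * s a) ∧
      ∀ r a, s (a * ηA r) = s a * ηE r) →
    ∃ j : A →A[ℂ] E, σ.comp j = ContinuousAlgHom.id ℂ A ∧ j.comp ηA = ηE

/-! ### The relative split exact structure -/

/-- `h` is a morphism of `R`-`S`-`⊗̂`-bimodules, the scalars being restricted along `ηA : R → A`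
and `ηB : S → B`. -/
def IsRelMorphism (ηA : R →A[ℂ] A) (ηB : S →A[ℂ] B) {X Y : HatBimodule A B} (h : X →L[ℂ] Y) :
    Prop :=
  (∀ (r : R) (x : X), h (ηA r • x) = ηA r • h x) ∧
    ∀ (s : S) (x : X), h (MulOpposite.op (ηB s) • x) = MulOpposite.op (ηB s) • h x

/-- `P` is projective in `(A, R)-mod-(B, S)`: morphisms out of `P` lift along every morphism that
is split by an `R`-`S`-`⊗̂`-bimodule morphism. -/
def IsRelProjective (ηA : R →A[ℂ] A) (ηB : S →A[ℂ] B) (P : HatBimodule A B) : Prop :=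
  ∀ (Y Z : HatBimodule A B) (σ : Y.Hom Z),
    (∃ s : Z →L[ℂ] Y, IsRelMorphism ηA ηB s ∧ ∀ z, σ (s z) = z) →
    ∀ φ : P.Hom Z, ∃ ψ : P.Hom Y, ∀ x, σ (ψ x) = φ x

/-- The sequence `0 ← M ← P₀ ← P₁ ← ⋯` of `A`-`B`-`⊗̂`-bimodules splits in `R-mod-S`: it has a
contracting homotopy consisting of `R`-`S`-`⊗̂`-bimodule morphisms. -/
def Splits (ηA : R →A[ℂ] A) (ηB : S →A[ℂ] B) {M : HatBimodule A B} {P : ℕ → HatBimodule A B}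
    (ε : (P 0).Hom M) (d : ∀ n, (P (n + 1)).Hom (P n)) : Prop :=
  ∃ (h₀ : M →L[ℂ] P 0) (h : ∀ n, P n →L[ℂ] P (n + 1)),
    IsRelMorphism ηA ηB h₀ ∧ (∀ n, IsRelMorphism ηA ηB (h n)) ∧
    (∀ m, ε (h₀ m) = m) ∧
    (∀ x, h₀ (ε x) + d 0 (h 0 x) = x) ∧
    ∀ n x, h n (d n x) + d (n + 1) (h (n + 1) x) = x

/-- `0 ← M ← P₀ ← P₁ ← ⋯` is a projective resolution of `M` in `(A, R)-mod-(B, S)`. -/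
structure IsRelProjectiveResolution (ηA : R →A[ℂ] A) (ηB : S →A[ℂ] B) {M : HatBimodule A B}
    {P : ℕ → HatBimodule A B} (ε : (P 0).Hom M) (d : ∀ n, (P (n + 1)).Hom (P n)) : Prop where
  projective : ∀ n, IsRelProjective ηA ηB (P n)
  aug_comp_d : ∀ x, ε (d 0 x) = 0
  d_comp_d : ∀ n x, d n (d (n + 1) x) = 0
  splits : Splits ηA ηB ε d

/-! ### Two-sided relative homological epimorphisms -/

/-- The identity morphism. -/
def HatBimodule.Hom.id (X : HatBimodule A B) : X.Hom X where
  toContinuousLinearMap := ContinuousLinearMap.id ℂ X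
  map_left' _ _ := rfl
  map_right' _ _ := rfl

/-- The `B`-`⊗̂`-bimodule `B ⊗̂_A P ⊗̂_A B`. -/
noncomputable def extendScalars (f : A →A[ℂ] B) (P : HatBimodule A A) : HatBimodule B B :=
  (((HatBimodule.regular B).restrict (ContinuousAlgHom.id ℂ B) f).balancedTensor P).balancedTensor
    ((HatBimodule.regular B).restrict f (ContinuousAlgHom.id ℂ B))

/-- The functor `B ⊗̂_A (-) ⊗̂_A B` on morphisms. -/
noncomputable def extendScalarsMap (f : A →A[ℂ] B) {P Q : HatBimodule A A} (φ : P.Hom Q) :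
    (extendScalars f P).Hom (extendScalars f Q) :=
  HatBimodule.balancedMap (HatBimodule.balancedMap (HatBimodule.Hom.id _) φ)
    (HatBimodule.Hom.id _)

/-- Two-sided relative homological epimorphisms: `f` is an epimorphism of `⊗̂`-algebras, and
`B ⊗̂_A (-) ⊗̂_A B` sends some projective resolution of `A` in `(A, R)-mod-(A, R)` to a sequence
that splits in `S-mod-S`. -/
def IsTwoSidedRelHomologicalEpi (ηA : R →A[ℂ] A) (ηB : S →A[ℂ] B) (f : A →A[ℂ] B) : Prop :=
  IsHatEpimorphism f ∧
    ∃ (P : ℕ → HatBimodule A A) (ε : (P 0).Hom (HatBimodule.regular A))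
      (d : ∀ n, (P (n + 1)).Hom (P n)),
      IsRelProjectiveResolution ηA ηA ε d ∧
        Splits ηB ηB (P := fun n => extendScalars f (P n)) (extendScalarsMap f ε)
          fun n => extendScalarsMap f (d n)

end Homological

/-! Write Ω for the bimodule Ω¹_R(A) of relative forms, the kernel of the multiplication of A ⊗̂_R
A. The sequence 0 ← A ← A ⊗̂_R A ← Ω ← 0 always splits over R, by a ↦ a ⊗ 1 and a ⊗ b ↦ a db, and A
⊗̂_R A is always relatively projective. Morphisms out of Ω correspond to derivations of A vanishing
on R. Splitting a suitable square-zero extension lifts such derivations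
(`IsRelativelyQuasiFree.exists_derivation_lift`), so relative quasi-freeness makes Ω projective, and
the sequence is a projective resolution of length one.

The functor B ⊗̂_A (-) ⊗̂_A B cannot simply be applied to this contracting homotopy: its two maps
are left A-linear, but on the right only R-linearity is available. The map into Ω has an explicit
defect: with p the projection and m the multiplication, p(t·a) = p(t)·a + m(t)·da
(`relForms.proj_op_smul`). Correcting for it over B requires a meaning for dc when c lies in B, and
Property (UDE) supplies it: a ↦ 1 ⊗ da ⊗ 1 extends along f to a derivation δ of B. Then b ⊗ t ⊗ c ↦
b·(1 ⊗ p(t) ⊗ 1)·c + b f(m(t))·δ(c) is balanced over A (`extendScalars.exists_lift_derivation`). In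
degree zero, the homotopy multiplies B ⊗̂_A A ⊗̂_A B into B and sends b to b·(1 ⊗ (1 ⊗ 1) ⊗ 1).

Density does the rest. Right linearity over S reduces to two identities, the centrality of 1 ⊗ (1 ⊗
1) ⊗ 1 and the vanishing of δ on S. Both hold on g(R), hence on S by continuity. Since f has dense
range, the homotopy identities need only be checked at elements b ⊗ p ⊗ 1
(`extendScalars.ext_of_denseRange`), where the new homotopy is the old one multiplied by b. Density
of f also makes f an epimorphism. -/

namespace LCBimodule

/-! ### Universal property of the completion of a bimodule -/

variable {A B : Type u} [Ring A] [Algebra ℂ A] [UniformSpace A] [IsTopologicalAddGroup A]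
  [Ring B] [Algebra ℂ B] [UniformSpace B] [IsTopologicalAddGroup B]

/-- The canonical map from a bimodule to its completion. -/
noncomputable def toCompletion (X : LCBimodule A B) : X →L[ℂ] X.completion where
  toFun x := (x : Completion X)
  map_add' := Completion.coe_add
  map_smul' := Completion.coe_smul
  cont := Completion.continuous_coe X

variable {X : LCBimodule A B}

theorem toCompletion_smul (a : A) (x : X) : X.toCompletion (a • x) = a • X.toCompletion x :=
  Completion.coe_smul a x

theorem toCompletion_op_smul (b : Bᵐᵒᵖ) (x : X) :
    X.toCompletion (b • x) = b • X.toCompletion x :=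
  Completion.coe_smul b x

theorem Hom.completion_toCompletion {Y : LCBimodule A B} (φ : X.Hom Y) (x : X) :
    φ.completion (X.toCompletion x) = Y.toCompletion (φ x) :=
  ContinuousLinearMap.completion_apply_coe φ.toContinuousLinearMap x

theorem completion_induction {motive : X.completion → Prop} (closed : IsClosed {t | motive t})
    (coe : ∀ x, motive (X.toCompletion x)) (t : X.completion) : motive t :=
  Completion.induction_on (α := X) (p := motive) t closed coe

variable {Z : Type*} [AddCommGroup Z] [Module ℂ Z] [UniformSpace Z] [IsCompleteLCS Z]

/-- The extension to the completion of a continuous linear map into a complete Hausdorff space. -/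
noncomputable def completionLift (φ : X →L[ℂ] Z) : X.completion →L[ℂ] Z where
  toFun := Completion.extension φ
  map_add' x y := by
    refine Completion.induction_on₂ (α := X) (β := X) (p := fun x y => Completion.extension φ
      (x + y) = Completion.extension φ x + Completion.extension φ y) x y ?_ fun x y => ?_
    · exact isClosed_eq (Completion.continuous_extension.comp continuous_add)
        ((Completion.continuous_extension.comp continuous_fst).add
          (Completion.continuous_extension.comp continuous_snd))
    · simp only [← Completion.coe_add, Completion.extension_coe φ.uniformContinuous, map_add]
  map_smul' c x := by
    refine Completion.induction_on (α := X) (p := fun x => Completion.extension φ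
      (c • x) = c • Completion.extension φ x) x ?_ fun x => ?_
    · exact isClosed_eq (Completion.continuous_extension.comp (continuous_const_smul c))
        (Completion.continuous_extension.const_smul c)
    · simp only [← Completion.coe_smul, Completion.extension_coe φ.uniformContinuous, map_smul]
  cont := Completion.continuous_extension

theorem completionLift_toCompletion (φ : X →L[ℂ] Z) (x : X) :
    completionLift φ (X.toCompletion x) = φ x :=
  Completion.extension_coe φ.uniformContinuous x

end LCBimodule

/-! ### Universal property of the complete and the balanced tensor product -/

namespace HatBimodule

variable {A B C : Type u}
  [Ring A] [Algebra ℂ A] [UniformSpace A] [Ring B] [Algebra ℂ B] [UniformSpace B]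
  [Ring C] [Algebra ℂ C] [UniformSpace C] [IsLCS A] [IsLCS C]

/-- The elementary tensor `x ⊗ y` in `X ⊗̂ Y` as a bilinear function of `x` and `y`. -/
noncomputable def tmulₗ (X : HatBimodule A B) (Y : HatBimodule B C) :
    X →ₗ[ℂ] Y →ₗ[ℂ] tensor X Y :=
  (ProjTensor.tmul : X →ₗ[ℂ] Y →ₗ[ℂ] ProjTensor X Y).compr₂
    (X.toLCBimodule.projTensor Y.toLCBimodule).toCompletion.toLinearMap

theorem continuous_tmul (X : HatBimodule A B) (Y : HatBimodule B C) :
    Continuous fun z : X × Y => tmul X Y z.1 z.2 :=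
  (Completion.continuous_coe (ProjTensor X Y)).comp ProjTensor.continuous_tmul

/-- The canonical map from `X ⊗̂ Y` to `X ⊗̂_B Y`. -/
noncomputable def toBalanced (X : HatBimodule A B) (Y : HatBimodule B C) :
    Hom (tensor X Y) (balancedTensor X Y) where
  toLinearMap := (LCBimodule.quotient (isSubbimodule_balancedRel X Y)).toCompletion.toLinearMap ∘ₗ
    (balancedRel X Y).mkQ
  cont := (LCBimodule.quotient (isSubbimodule_balancedRel X Y)).toCompletion.continuous.comp
    (balancedRel X Y).continuous_mkQ
  map_left' a t := LCBimodule.toCompletion_smul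
    (X := LCBimodule.quotient (isSubbimodule_balancedRel X Y)) a ((balancedRel X Y).mkQ t)
  map_right' c t := LCBimodule.toCompletion_op_smul
    (X := LCBimodule.quotient (isSubbimodule_balancedRel X Y)) c ((balancedRel X Y).mkQ t)

/-- The elementary tensor `x ⊗ y` in `X ⊗̂_B Y`. -/
noncomputable def btmul (X : HatBimodule A B) (Y : HatBimodule B C) :
    X →ₗ[ℂ] Y →ₗ[ℂ] balancedTensor X Y :=
  (tmulₗ X Y).compr₂ (toBalanced X Y).toLinearMap

variable {X : HatBimodule A B} {Y : HatBimodule B C}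

theorem toBalanced_tmul (x : X) (y : Y) : toBalanced X Y (tmul X Y x y) = btmul X Y x y := rfl

theorem continuous_btmul : Continuous fun z : X × Y => btmul X Y z.1 z.2 :=
  (toBalanced X Y).continuous.comp (continuous_tmul X Y)

theorem op_smul_btmul_eq (x : X) (b : B) (y : Y) :
    btmul X Y (MulOpposite.op b • x) y = btmul X Y x (b • y) := by
  have h : (balancedRel X Y).mkQ (tmul X Y (MulOpposite.op b • x) y) =
      (balancedRel X Y).mkQ (tmul X Y x (b • y)) :=
    (Submodule.Quotient.eq (balancedRel X Y)).2
      (subset_closure (Submodule.subset_span ⟨x, b, y, rfl⟩))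
  exact congrArg (LCBimodule.quotient (isSubbimodule_balancedRel X Y)).toCompletion h

theorem smul_btmul (a : A) (x : X) (y : Y) :
    a • btmul X Y x y = btmul X Y (a • x) y := by
  rw [← toBalanced_tmul, ← LCBimodule.Hom.map_left, smul_tmul, toBalanced_tmul]

theorem op_smul_btmul (c : Cᵐᵒᵖ) (x : X) (y : Y) :
    c • btmul X Y x y = btmul X Y x (c • y) := by
  rw [← toBalanced_tmul, ← LCBimodule.Hom.map_right, op_smul_tmul, toBalanced_tmul]

theorem balancedMap_btmul {X' : HatBimodule A B} {Y' : HatBimodule B C}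
    (φ : Hom X X') (ψ : Hom Y Y') (x : X) (y : Y) :
    balancedMap φ ψ (btmul X Y x y) = btmul X' Y' (φ x) (ψ y) := by
  refine (LCBimodule.Hom.completion_toCompletion ((tensorMap φ ψ).quotient
    (isSubbimodule_balancedRel X Y) (isSubbimodule_balancedRel X' Y')
    (tensorMap_balancedRel φ ψ)) ((balancedRel X Y).mkQ (tmul X Y x y))).trans ?_
  exact congrArg (toBalanced X' Y') (tensorMap_tmul φ ψ x y)

/-- A closed additive property that holds for elementary tensors holds on all of `X ⊗̂_B Y`. -/
theorem btmul_induction {motive : balancedTensor X Y → Prop}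
    (closed : IsClosed {t | motive t}) (add : ∀ s t, motive s → motive t → motive (s + t))
    (btmul : ∀ x y, motive (btmul X Y x y)) (t : balancedTensor X Y) : motive t := by
  -- Two completions have to be crossed: the quotient is dense in X ⊗̂_B Y, and after lifting from
  -- the quotient to X ⊗̂ Y, the algebraic tensors are dense there.
  refine LCBimodule.completion_induction (X := LCBimodule.quotient (isSubbimodule_balancedRel X Y))
    (motive := motive) closed (fun q => ?_) t
  obtain ⟨s, rfl⟩ := (balancedRel X Y).mkQ_surjective q
  change motive (toBalanced X Y s)
  refine LCBimodule.completion_induction (X := X.toLCBimodule.projTensor Y.toLCBimodule)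
    (motive := fun s => motive (toBalanced X Y s))
    (closed.preimage (toBalanced X Y).continuous) (fun p => ?_) s
  refine ProjTensor.induction_on (motive := fun p => motive (toBalanced X Y
    ((X.toLCBimodule.projTensor Y.toLCBimodule).toCompletion p))) p btmul fun s t hs ht => ?_
  have h := add _ _ hs ht
  have e := map_add (((toBalanced X Y).toContinuousLinearMap).comp
    (X.toLCBimodule.projTensor Y.toLCBimodule).toCompletion) s t
  exact (congrArg motive e).mpr h

/-- Continuous additive maps on `X ⊗̂_B Y` are determined by their values on elementary tensors. -/
theorem balancedTensor_ext {Z : Type*} [AddCommGroup Z] [Module ℂ Z] [TopologicalSpace Z]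
    [T2Space Z] {φ ψ : balancedTensor X Y →L[ℂ] Z}
    (h : ∀ x y, φ (btmul X Y x y) = ψ (btmul X Y x y)) : φ = ψ := by
  ext t
  induction t using btmul_induction with
  | closed => exact isClosed_eq φ.continuous ψ.continuous
  | add s t hs ht => rw [map_add, map_add, hs, ht]
  | btmul x y => exact h x y

section Lift

variable {Z : Type*} [AddCommGroup Z] [Module ℂ Z] [UniformSpace Z] [IsCompleteLCS Z]

/-- The continuous linear map `X ⊗̂ Y → Z` given by a jointly continuous bilinear map. -/
noncomputable def tensorLift (b : X →ₗ[ℂ] Y →ₗ[ℂ] Z)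
    (hb : Continuous fun z : X × Y => b z.1 z.2) : tensor X Y →L[ℂ] Z :=
  LCBimodule.completionLift (X := X.toLCBimodule.projTensor Y.toLCBimodule)
    ⟨TensorProduct.lift b, ProjTensor.continuous_lift (E := X) (F := Y)
      (TensorProduct.lift b : ProjTensor X Y →ₗ[ℂ] Z) hb⟩

theorem tensorLift_tmul (b : X →ₗ[ℂ] Y →ₗ[ℂ] Z)
    (hb : Continuous fun z : X × Y => b z.1 z.2) (x : X) (y : Y) :
    tensorLift b hb (tmul X Y x y) = b x y :=
  LCBimodule.completionLift_toCompletion (X := X.toLCBimodule.projTensor Y.toLCBimodule) _ _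

/-- The continuous linear map `X ⊗̂_B Y → Z` given by a jointly continuous balanced bilinear map. -/
noncomputable def balancedLift (b : X →ₗ[ℂ] Y →ₗ[ℂ] Z)
    (hb : Continuous fun z : X × Y => b z.1 z.2)
    (h : ∀ x (c : B) y, b (MulOpposite.op c • x) y = b x (c • y)) : balancedTensor X Y →L[ℂ] Z :=
  LCBimodule.completionLift (X := LCBimodule.quotient (isSubbimodule_balancedRel X Y))
    { toLinearMap := (balancedRel X Y).liftQ (tensorLift b hb).toLinearMap (by
        -- The kernel of a continuous linear map into a Hausdorff space is closed, so it contains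
        -- the closed span of the relators as soon as it contains each of them.
        refine Submodule.topologicalClosure_minimal _ (Submodule.span_le.2 ?_)
          (isClosed_singleton.preimage (tensorLift b hb).continuous)
        rintro _ ⟨x, c, y, rfl⟩
        refine (map_sub (tensorLift b hb) _ _).trans ?_
        rw [tensorLift_tmul, tensorLift_tmul, h, sub_self])
      cont := (balancedRel X Y).isQuotientMap_mkQ.continuous_iff.2 (tensorLift b hb).continuous }

theorem balancedLift_btmul (b : X →ₗ[ℂ] Y →ₗ[ℂ] Z)
    (hb : Continuous fun z : X × Y => b z.1 z.2)
    (h : ∀ x (c : B) y, b (MulOpposite.op c • x) y = b x (c • y)) (x : X) (y : Y) :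
    balancedLift b hb h (btmul X Y x y) = b x y :=
  (LCBimodule.completionLift_toCompletion
    (X := LCBimodule.quotient (isSubbimodule_balancedRel X Y)) _
    ((balancedRel X Y).mkQ (tmul X Y x y))).trans (tensorLift_tmul b hb x y)

end Lift

attribute [local irreducible] balancedTensor balancedMap
attribute [irreducible] toBalanced btmul balancedLift

/-- The map `x ↦ x ⊗ y`. -/
noncomputable def btmulLeft (y : Y) : X →L[ℂ] balancedTensor X Y where
  toLinearMap := (btmul X Y).flip y
  cont := by
    have h : Continuous fun x : X => (x, y) := continuous_id.prodMk continuous_const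
    exact continuous_btmul.comp h

/-- The map `y ↦ x ⊗ y`. -/
noncomputable def btmulRight (x : X) : Y →L[ℂ] balancedTensor X Y where
  toLinearMap := btmul X Y x
  cont := by
    have h : Continuous fun y : Y => (x, y) := continuous_const.prodMk continuous_id
    exact continuous_btmul.comp h

end HatBimodule

attribute [local irreducible] HatBimodule.balancedTensor HatBimodule.balancedMap

/-! ### Closed sub-bimodules, the zero bimodule, and actions as continuous maps -/

namespace HatBimodule

section Sub

variable {A B : Type u} [Ring A] [Algebra ℂ A] [UniformSpace A]
  [Ring B] [Algebra ℂ B] [UniformSpace B]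

theorem submodule_isLCS {E : Type*} [AddCommGroup E] [Module ℂ E] [UniformSpace E] [IsLCS E]
    (N : Submodule ℂ E) : IsLCS N := by
  have : IsUniformAddGroup N := N.toAddSubgroup.isUniformAddGroup
  have : LocallyConvexSpace ℝ N :=
    LocallyConvexSpace.induced (N.subtype.restrictScalars ℝ)
  exact {}

/-- A closed sub-bimodule of a `⊗̂`-bimodule. -/
def sub (X : HatBimodule A B) (N : Submodule ℂ X) (hN : X.IsSubbimodule N)
    (hc : IsClosed (N : Set X)) : HatBimodule A B :=
  letI : SMul A N := ⟨fun a x => ⟨a • x.1, hN.left a _ x.2⟩⟩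
  letI : SMul Bᵐᵒᵖ N := ⟨fun a x => ⟨a • x.1, hN.right a _ x.2⟩⟩
  letI : Module A N := Function.Injective.module A N.subtype.toAddMonoidHom
    Subtype.val_injective fun _ _ => rfl
  letI : Module Bᵐᵒᵖ N := Function.Injective.module Bᵐᵒᵖ N.subtype.toAddMonoidHom
    Subtype.val_injective fun _ _ => rfl
  { carrier := N
    isLCS := submodule_isLCS N
    smulCommClass := ⟨fun a b x => Subtype.ext (smul_comm a b x.1)⟩
    left_isScalarTower := ⟨fun z a x => Subtype.ext (smul_assoc z a x.1)⟩
    right_isScalarTower := ⟨fun z a x => Subtype.ext (smul_assoc z a x.1)⟩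
    left_continuousSMul := ⟨Continuous.subtype_mk (continuous_smul.comp
      (continuous_fst.prodMk (continuous_subtype_val.comp continuous_snd))) _⟩
    right_continuousSMul := ⟨Continuous.subtype_mk (continuous_smul.comp
      (continuous_fst.prodMk (continuous_subtype_val.comp continuous_snd))) _⟩
    completeSpace := hc.completeSpace_coe
    t2Space := inferInstanceAs (T2Space N) }

/-- The inclusion of a closed sub-bimodule. -/
def subIncl (X : HatBimodule A B) (N : Submodule ℂ X) (hN : X.IsSubbimodule N)
    (hc : IsClosed (N : Set X)) : (sub X N hN hc).Hom X where
  toContinuousLinearMap := N.subtypeL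
  map_left' _ _ := rfl
  map_right' _ _ := rfl

theorem subIncl_injective (X : HatBimodule A B) (N : Submodule ℂ X) (hN : X.IsSubbimodule N)
    (hc : IsClosed (N : Set X)) : Function.Injective (subIncl X N hN hc) :=
  Subtype.val_injective

theorem subIncl_mem {X : HatBimodule A B} {N : Submodule ℂ X} {hN : X.IsSubbimodule N}
    {hc : IsClosed (N : Set X)} (x : sub X N hN hc) : subIncl X N hN hc x ∈ N := x.2

/-- A continuous linear map into a closed sub-bimodule. -/
def subCodRestrict {E : Type*} [AddCommGroup E] [Module ℂ E] [TopologicalSpace E]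
    {X : HatBimodule A B} {N : Submodule ℂ X} (hN : X.IsSubbimodule N)
    (hc : IsClosed (N : Set X)) (φ : E →L[ℂ] X) (h : ∀ x, φ x ∈ N) : E →L[ℂ] sub X N hN hc :=
  φ.codRestrict N h

/-- The zero morphism. -/
def Hom.zero (X Y : HatBimodule A B) : X.Hom Y where
  toContinuousLinearMap := 0
  map_left' a _ := (smul_zero a).symm
  map_right' b _ := (smul_zero b).symm

/-- The zero bimodule. -/
def zero (A : Type u) [Ring A] [Algebra ℂ A] [UniformSpace A] [IsTensorHatAlgebra A] :
    HatBimodule A A :=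
  sub (regular A) ⊥ ⟨fun a x hx => by rw [(Submodule.mem_bot ℂ).1 hx, smul_zero]; exact zero_mem _,
    fun a x hx => by rw [(Submodule.mem_bot ℂ).1 hx, smul_zero]; exact zero_mem _⟩
    (isClosed_singleton (X := A))

instance (A : Type u) [Ring A] [Algebra ℂ A] [UniformSpace A] [IsTensorHatAlgebra A] :
    Subsingleton (zero A) :=
  inferInstanceAs (Subsingleton (⊥ : Submodule ℂ A))

end Sub

section Actions

variable {A B : Type u} [Ring A] [Algebra ℂ A] [UniformSpace A]
  [Ring B] [Algebra ℂ B] [UniformSpace B]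

/-- The bilinear map `(a, x) ↦ a • φ x` for a linear map `φ`. -/
def smulBilin {E : Type*} [AddCommGroup E] [Module ℂ E] [TopologicalSpace E]
    {X : HatBimodule A B} (φ : E →L[ℂ] X) : A →ₗ[ℂ] E →ₗ[ℂ] X :=
  LinearMap.mk₂ ℂ (fun a x => a • φ x) (fun a b x => add_smul a b _)
    (fun c a x => smul_assoc c a _) (fun a x y => by rw [map_add, smul_add])
    (fun c a x => by rw [map_smul, smul_comm])

theorem smulBilin_apply {E : Type*} [AddCommGroup E] [Module ℂ E] [TopologicalSpace E]
    {X : HatBimodule A B} (φ : E →L[ℂ] X) (a : A) (x : E) : smulBilin φ a x = a • φ x := rfl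

theorem continuous_smulBilin {E : Type*} [AddCommGroup E] [Module ℂ E] [TopologicalSpace E]
    {X : HatBimodule A B} (φ : E →L[ℂ] X) :
    Continuous fun z : A × E => smulBilin φ z.1 z.2 :=
  continuous_smul.comp (continuous_fst.prodMk (φ.continuous.comp continuous_snd))

/-- The map `x ↦ a · x`. -/
noncomputable def smulCLM (X : HatBimodule A B) (a : A) : X →L[ℂ] X :=
  ⟨Algebra.lsmul ℂ ℂ X a, continuous_const_smul a⟩

/-- The map `x ↦ x · b`. -/
noncomputable def opSMulCLM (X : HatBimodule A B) (b : Bᵐᵒᵖ) : X →L[ℂ] X :=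
  ⟨Algebra.lsmul ℂ ℂ X b, continuous_const_smul b⟩

/-- The map `b ↦ x · b`. -/
noncomputable def opSMulRight (X : HatBimodule A B) (x : X) : B →L[ℂ] X where
  toFun b := MulOpposite.op b • x
  map_add' a b := by rw [MulOpposite.op_add, add_smul]
  map_smul' c b := by rw [MulOpposite.op_smul, smul_assoc, RingHom.id_apply]
  cont := continuous_smul.comp (MulOpposite.continuous_op.prodMk continuous_const)

end Actions

end HatBimodule

/-! ### The bimodule A ⊗̂_R A -/

section Free

open HatBimodule

variable {A R : Type u} [Ring A] [Algebra ℂ A] [UniformSpace A] [IsTensorHatAlgebra A]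
  [Ring R] [Algebra ℂ R] [UniformSpace R] (η : R →A[ℂ] A)

/-- The `A`-`⊗̂`-bimodule `A ⊗̂_R A`. -/
noncomputable def relFree : HatBimodule A A :=
  ((regular A).restrict (ContinuousAlgHom.id ℂ A) η).balancedTensor
    ((regular A).restrict η (ContinuousAlgHom.id ℂ A))

/-- The elementary tensor `a ⊗ b` in `A ⊗̂_R A`. -/
noncomputable def relFree.mk : A →ₗ[ℂ] A →ₗ[ℂ] relFree η :=
  btmul ((regular A).restrict (ContinuousAlgHom.id ℂ A) η)
    ((regular A).restrict η (ContinuousAlgHom.id ℂ A))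

namespace relFree

variable {η}

theorem smul_mk (a b c : A) : a • mk η b c = mk η (a * b) c :=
  smul_btmul (X := (regular A).restrict (ContinuousAlgHom.id ℂ A) η)
    (Y := (regular A).restrict η (ContinuousAlgHom.id ℂ A)) a b c

theorem op_smul_mk (a b c : A) : MulOpposite.op a • mk η b c = mk η b (c * a) :=
  op_smul_btmul (X := (regular A).restrict (ContinuousAlgHom.id ℂ A) η)
    (Y := (regular A).restrict η (ContinuousAlgHom.id ℂ A)) (MulOpposite.op a) b c

theorem mk_mul (b : A) (r : R) (c : A) : mk η (b * η r) c = mk η b (η r * c) :=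
  op_smul_btmul_eq (X := (regular A).restrict (ContinuousAlgHom.id ℂ A) η)
    (Y := (regular A).restrict η (ContinuousAlgHom.id ℂ A)) b r c

theorem ext {Z : Type*} [AddCommGroup Z] [Module ℂ Z] [TopologicalSpace Z]
    [T2Space Z] {φ ψ : relFree η →L[ℂ] Z} (h : ∀ a b, φ (mk η a b) = ψ (mk η a b)) (t : relFree η) :
    φ t = ψ t :=
  DFunLike.congr_fun (balancedTensor_ext h) t

theorem exists_lift {Z : Type*} [AddCommGroup Z] [Module ℂ Z] [UniformSpace Z] [IsCompleteLCS Z]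
    (b : A →ₗ[ℂ] A →ₗ[ℂ] Z) (hb : Continuous fun z : A × A => b z.1 z.2)
    (h : ∀ x r y, b (x * η r) y = b x (η r * y)) :
    ∃ φ : relFree η →L[ℂ] Z, ∀ x y, φ (mk η x y) = b x y :=
  ⟨balancedLift (X := (regular A).restrict (ContinuousAlgHom.id ℂ A) η)
    (Y := (regular A).restrict η (ContinuousAlgHom.id ℂ A)) b hb h,
    balancedLift_btmul (X := (regular A).restrict (ContinuousAlgHom.id ℂ A) η)
    (Y := (regular A).restrict η (ContinuousAlgHom.id ℂ A)) b hb h⟩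

/-- The map `b ↦ a ⊗ b`. -/
noncomputable def mkRight (a : A) : A →L[ℂ] relFree η :=
  btmulRight (X := (regular A).restrict (ContinuousAlgHom.id ℂ A) η)
    (Y := (regular A).restrict η (ContinuousAlgHom.id ℂ A)) a

theorem mkRight_apply (a b : A) : mkRight (η := η) a b = mk η a b := rfl

/-- The map `a ↦ a ⊗ b`. -/
noncomputable def mkLeft (b : A) : A →L[ℂ] relFree η :=
  btmulLeft (X := (regular A).restrict (ContinuousAlgHom.id ℂ A) η)
    (Y := (regular A).restrict η (ContinuousAlgHom.id ℂ A)) b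

theorem mkLeft_apply (a b : A) : mkLeft (η := η) b a = mk η a b := rfl

attribute [irreducible] relFree relFree.mk relFree.mkRight relFree.mkLeft

end relFree

end Free

/-! ### Elementary tensors in B ⊗̂_A P ⊗̂_A B -/

section ExtendScalars

open HatBimodule

variable {A B : Type u} [Ring A] [Algebra ℂ A] [UniformSpace A] [IsTensorHatAlgebra A]
  [Ring B] [Algebra ℂ B] [UniformSpace B] [IsTensorHatAlgebra B] (f : A →A[ℂ] B)
  (P : HatBimodule A A)

/-- The `B`-`A`-`⊗̂`-bimodule `B ⊗̂_A P`. -/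
noncomputable def leftExtend : HatBimodule B A :=
  ((regular B).restrict (ContinuousAlgHom.id ℂ B) f).balancedTensor P

/-- The elementary tensor `b ⊗ p` in `B ⊗̂_A P`. -/
noncomputable def leftExtend.mk : B →ₗ[ℂ] P →ₗ[ℂ] leftExtend f P :=
  btmul ((regular B).restrict (ContinuousAlgHom.id ℂ B) f) P

/-- The elementary tensor `t ⊗ b` in `(B ⊗̂_A P) ⊗̂_A B`. -/
noncomputable def extendScalars.mk : leftExtend f P →ₗ[ℂ] B →ₗ[ℂ] extendScalars f P :=
  btmul (leftExtend f P) ((regular B).restrict f (ContinuousAlgHom.id ℂ B))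

variable {f P}

namespace leftExtend

theorem smul_mk (b c : B) (p : P) : b • mk f P c p = mk f P (b * c) p :=
  smul_btmul (X := (regular B).restrict (ContinuousAlgHom.id ℂ B) f) (Y := P) b c p

theorem op_smul_mk (a : Aᵐᵒᵖ) (b : B) (p : P) : a • mk f P b p = mk f P b (a • p) :=
  op_smul_btmul (X := (regular B).restrict (ContinuousAlgHom.id ℂ B) f) (Y := P) a b p

theorem mk_mul (b : B) (a : A) (p : P) : mk f P (b * f a) p = mk f P b (a • p) :=
  op_smul_btmul_eq (X := (regular B).restrict (ContinuousAlgHom.id ℂ B) f) (Y := P) b a p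

theorem ext {Z : Type*} [AddCommGroup Z] [Module ℂ Z] [TopologicalSpace Z]
    [T2Space Z] {φ ψ : leftExtend f P →L[ℂ] Z} (h : ∀ b p, φ (mk f P b p) = ψ (mk f P b p))
    (t : leftExtend f P) : φ t = ψ t :=
  DFunLike.congr_fun (balancedTensor_ext h) t

variable (f P) in
/-- The map `p ↦ b ⊗ p`. -/
noncomputable def mkRight (b : B) : P →L[ℂ] leftExtend f P :=
  btmulRight (X := (regular B).restrict (ContinuousAlgHom.id ℂ B) f) (Y := P) b

theorem mkRight_apply (b : B) (p : P) : mkRight f P b p = mk f P b p := rfl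

theorem exists_lift_bilinear {Z : Type*} [AddCommGroup Z] [Module ℂ Z] [UniformSpace Z]
    [IsCompleteLCS Z] (b : B →ₗ[ℂ] P →ₗ[ℂ] Z) (hb : Continuous fun z : B × P => b z.1 z.2)
    (h : ∀ x a p, b (x * f a) p = b x (a • p)) :
    ∃ φ : leftExtend f P →L[ℂ] Z, ∀ x p, φ (mk f P x p) = b x p :=
  ⟨balancedLift (X := (regular B).restrict (ContinuousAlgHom.id ℂ B) f) (Y := P) b hb h,
    balancedLift_btmul (X := (regular B).restrict (ContinuousAlgHom.id ℂ B) f) (Y := P) b hb h⟩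

/-- Only left linearity of `κ` is demanded. The maps that matter later are right linear merely up to
a derivation, so the right-hand factor B has to be attached separately. -/
theorem exists_lift {X : HatBimodule B B} (κ : P →L[ℂ] X)
    (h : ∀ (a : A) p, κ (a • p) = f a • κ p) :
    ∃ φ : leftExtend f P →L[ℂ] X, (∀ b p, φ (mk f P b p) = b • κ p) ∧
      ∀ (b : B) t, φ (b • t) = b • φ t := by
  have : IsCompleteLCS X := {}
  obtain ⟨φ, hφ⟩ := exists_lift_bilinear (f := f) (P := P) (smulBilin κ) (continuous_smulBilin κ)
    fun x a p => by rw [smulBilin_apply, smulBilin_apply, h, mul_smul]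
  refine ⟨φ, hφ, fun b t => ?_⟩
  refine ext (f := f) (P := P) (φ := φ.comp (smulCLM _ b)) (ψ := (smulCLM X b).comp φ)
    (fun c p => ?_) t
  change φ (b • mk f P c p) = b • φ (mk f P c p)
  rw [smul_mk, hφ, hφ, smulBilin_apply, smulBilin_apply, mul_smul]

end leftExtend

namespace extendScalars

variable (f P) in
/-- The map `t ↦ t ⊗ c`. -/
noncomputable def mkLeft (c : B) : leftExtend f P →L[ℂ] extendScalars f P :=
  btmulLeft (X := leftExtend f P) (Y := (regular B).restrict f (ContinuousAlgHom.id ℂ B)) c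

variable (f P) in
theorem mkLeft_apply (c : B) (t : leftExtend f P) : mkLeft f P c t = mk f P t c := rfl

theorem smul_mk (b : B) (t : leftExtend f P) (c : B) : b • mk f P t c = mk f P (b • t) c :=
  smul_btmul (X := leftExtend f P) (Y := (regular B).restrict f (ContinuousAlgHom.id ℂ B)) b t c

theorem op_smul_mk (b : B) (t : leftExtend f P) (c : B) :
    MulOpposite.op b • mk f P t c = mk f P t (c * b) :=
  op_smul_btmul (X := leftExtend f P) (Y := (regular B).restrict f (ContinuousAlgHom.id ℂ B))
    (MulOpposite.op b) t c

theorem mk_mul (t : leftExtend f P) (a : A) (b : B) :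
    mk f P t (f a * b) = mk f P (MulOpposite.op a • t) b :=
  (op_smul_btmul_eq (X := leftExtend f P)
    (Y := (regular B).restrict f (ContinuousAlgHom.id ℂ B)) t a b).symm

theorem exists_lift {Z : Type*} [AddCommGroup Z] [Module ℂ Z] [UniformSpace Z] [IsCompleteLCS Z]
    (b : leftExtend f P →ₗ[ℂ] B →ₗ[ℂ] Z) (hb : Continuous fun z : leftExtend f P × B => b z.1 z.2)
    (h : ∀ t a c, b (MulOpposite.op a • t) c = b t (f a * c)) :
    ∃ φ : extendScalars f P →L[ℂ] Z, ∀ t c, φ (mk f P t c) = b t c :=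
  ⟨balancedLift (X := leftExtend f P) (Y := (regular B).restrict f (ContinuousAlgHom.id ℂ B)) b hb h,
    balancedLift_btmul (X := leftExtend f P)
      (Y := (regular B).restrict f (ContinuousAlgHom.id ℂ B)) b hb h⟩

theorem ext' {Z : Type*} [AddCommGroup Z] [Module ℂ Z] [TopologicalSpace Z]
    [T2Space Z] {φ ψ : extendScalars f P →L[ℂ] Z}
    (h : ∀ t c, φ (mk f P t c) = ψ (mk f P t c)) (x : extendScalars f P) : φ x = ψ x :=
  DFunLike.congr_fun (balancedTensor_ext h) x

theorem ext {Z : Type*} [AddCommGroup Z] [Module ℂ Z] [TopologicalSpace Z]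
    [T2Space Z] {φ ψ : extendScalars f P →L[ℂ] Z}
    (h : ∀ b p c, φ (mk f P (leftExtend.mk f P b p) c) = ψ (mk f P (leftExtend.mk f P b p) c))
    (x : extendScalars f P) : φ x = ψ x := by
  refine ext' (fun t c => ?_) x
  exact leftExtend.ext (φ := φ.comp (mkLeft f P c)) (ψ := ψ.comp (mkLeft f P c))
    (fun b p => h b p c) t

theorem map_mk {Q : HatBimodule A A} (φ : P.Hom Q) (b : B) (p : P) (c : B) :
    extendScalarsMap f φ (mk f P (leftExtend.mk f P b p) c) =
      mk f Q (leftExtend.mk f Q b (φ p)) c :=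
  (balancedMap_btmul _ _ _ _).trans
    (congrArg (mk f Q · c) (balancedMap_btmul _ _ _ _))

theorem subsingleton [Subsingleton P] (x : extendScalars f P) : x = 0 :=
  ext (φ := .id ℂ _) (ψ := 0) (fun b p c => by
    rw [Subsingleton.elim p 0, map_zero, map_zero, LinearMap.zero_apply, map_zero, map_zero]) x

end extendScalars

attribute [irreducible] leftExtend leftExtend.mk leftExtend.mkRight
  extendScalars.mk extendScalars.mkLeft

end ExtendScalars

/-! ### Relative differential forms and the universal derivation -/

section Forms

open HatBimodule

variable {A R : Type u} [Ring A] [Algebra ℂ A] [UniformSpace A] [IsTensorHatAlgebra A]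
  [Ring R] [Algebra ℂ R] [UniformSpace R] (η : R →A[ℂ] A)

theorem relFree.exists_mul :
    ∃ φ : relFree η →L[ℂ] A, ∀ a b, φ (relFree.mk η a b) = a * b :=
  relFree.exists_lift (LinearMap.mul ℂ A) continuous_mul fun x r y => mul_assoc x (η r) y

/-- The map `A ⊗̂_R A → A` given by the multiplication. -/
noncomputable def relFree.mul : relFree η →L[ℂ] A := (relFree.exists_mul η).choose

variable {η}

theorem relFree.mul_mk (a b : A) : relFree.mul η (relFree.mk η a b) = a * b :=
  (relFree.exists_mul η).choose_spec a b

theorem relFree.mul_smul (a : A) (t : relFree η) :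
    relFree.mul η (a • t) = a * relFree.mul η t :=
  relFree.ext (φ := (relFree.mul η).comp (smulCLM _ a))
    (ψ := (ContinuousLinearMap.mk (LinearMap.mulLeft ℂ a) (continuous_const_mul a)).comp
      (relFree.mul η)) (fun b c => by
    change relFree.mul η (a • relFree.mk η b c) = a * relFree.mul η (relFree.mk η b c)
    rw [relFree.smul_mk, relFree.mul_mk, relFree.mul_mk, mul_assoc]) t

theorem relFree.mul_op_smul (a : A) (t : relFree η) :
    relFree.mul η (MulOpposite.op a • t) = relFree.mul η t * a :=
  relFree.ext (φ := (relFree.mul η).comp (opSMulCLM _ (MulOpposite.op a)))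
    (ψ := (ContinuousLinearMap.mk (LinearMap.mulRight ℂ a) (continuous_mul_const a)).comp
      (relFree.mul η)) (fun b c => by
    change relFree.mul η (MulOpposite.op a • relFree.mk η b c) =
      relFree.mul η (relFree.mk η b c) * a
    rw [relFree.op_smul_mk, relFree.mul_mk, relFree.mul_mk, mul_assoc]) t

variable (η) in
/-- The multiplication `A ⊗̂_R A → A` as a bimodule morphism. -/
noncomputable def relFree.mulHom : (relFree η).Hom (regular A) where
  toContinuousLinearMap := (relFree.mul η : relFree η →L[ℂ] A)
  map_left' := relFree.mul_smul
  map_right' a := relFree.mul_op_smul a.unop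

theorem relFree.mulHom_apply (t : relFree η) : relFree.mulHom η t = relFree.mul η t := rfl

theorem relFree.isSubbimodule_ker_mul :
    (relFree η).IsSubbimodule (LinearMap.ker (relFree.mul η : relFree η →ₗ[ℂ] A)) where
  left a x hx := by
    have hx' : relFree.mul η x = 0 := hx
    change relFree.mul η (a • x) = 0
    rw [relFree.mul_smul, hx', mul_zero]
  right a x hx := by
    have hx' : relFree.mul η x = 0 := hx
    change relFree.mul η (MulOpposite.op a.unop • x) = 0
    rw [relFree.mul_op_smul, hx', zero_mul]

theorem relFree.isClosed_ker_mul :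
    IsClosed (LinearMap.ker (relFree.mul η : relFree η →ₗ[ℂ] A) : Set (relFree η)) :=
  isClosed_singleton.preimage (relFree.mul η).continuous

variable (η) in
/-- The bimodule `Ω¹_R(A)` of relative noncommutative differential forms, i.e. the kernel of the
multiplication `A ⊗̂_R A → A`. -/
noncomputable def relForms : HatBimodule A A :=
  sub (relFree η) _ relFree.isSubbimodule_ker_mul relFree.isClosed_ker_mul

namespace relForms

variable (η) in
/-- The inclusion of `Ω¹_R(A)` into `A ⊗̂_R A`. -/
noncomputable def incl : (relForms η).Hom (relFree η) :=
  subIncl (relFree η) _ relFree.isSubbimodule_ker_mul relFree.isClosed_ker_mul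

/-- Identities between forms are checked below inside A ⊗̂_R A, where they become computations with
tensors. -/
theorem incl_injective : Function.Injective (incl η) := subIncl_injective _ _ _ _

theorem mul_incl (ω : relForms η) : relFree.mul η (incl η ω) = 0 := subIncl_mem ω

variable (η) in
/-- The projection `a ⊗ b ↦ a db` of `A ⊗̂_R A` onto `Ω¹_R(A)`. -/
noncomputable def proj : relFree η →L[ℂ] relForms η :=
  subCodRestrict _ _ (.id ℂ _ - (relFree.mkLeft 1).comp (relFree.mul η)) fun t => by
    change relFree.mul η (t - relFree.mkLeft 1 (relFree.mul η t)) = 0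
    rw [map_sub, relFree.mkLeft_apply, relFree.mul_mk, mul_one, sub_self]

theorem incl_proj (t : relFree η) :
    incl η (proj η t) = t - relFree.mk η (relFree.mul η t) 1 := by
  rw [← relFree.mkLeft_apply]
  rfl

variable (η) in
/-- The universal derivation `A → Ω¹_R(A)`. -/
noncomputable def d : A →L[ℂ] relForms η := (proj η).comp (relFree.mkRight 1)

theorem incl_d (a : A) : incl η (d η a) = relFree.mk η 1 a - relFree.mk η a 1 := by
  refine (incl_proj (relFree.mkRight 1 a)).trans ?_
  rw [relFree.mkRight_apply, relFree.mul_mk, one_mul]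

attribute [irreducible] relForms incl proj d

/-- The correction term `mul t ⊗ 1` in the projection is zero on the kernel of multiplication. -/
theorem proj_incl (ω : relForms η) : proj η (incl η ω) = ω :=
  incl_injective (by rw [incl_proj, mul_incl, map_zero, LinearMap.zero_apply, sub_zero])

theorem proj_smul (a : A) (t : relFree η) : proj η (a • t) = a • proj η t :=
  incl_injective (by
    rw [LCBimodule.Hom.map_left, incl_proj, incl_proj, relFree.mul_smul, smul_sub,
      relFree.smul_mk])

/-- The summand `mul t • da` measures how far the projection is from being right A-linear. It
vanishes for a in the image of R, which makes the projection an R-bimodule map and hence usable in a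
contracting homotopy over R. Over B the same defect is compensated by the derivation that (UDE)
provides. -/
theorem proj_op_smul (a : A) (t : relFree η) :
    proj η (MulOpposite.op a • t) = MulOpposite.op a • proj η t + relFree.mul η t • d η a :=
  incl_injective (by
    have h := map_add (incl η).toContinuousLinearMap
      (MulOpposite.op a • proj η t) (relFree.mul η t • d η a)
    simp only [LCBimodule.Hom.coe_toCLM] at h
    rw [h, LCBimodule.Hom.map_right, LCBimodule.Hom.map_left, incl_proj, incl_proj, incl_d,
      relFree.mul_op_smul, smul_sub, smul_sub, relFree.op_smul_mk, relFree.smul_mk,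
      relFree.smul_mk, one_mul, mul_one]
    abel)

theorem proj_mk (a b : A) : proj η (relFree.mk η a b) = a • d η b :=
  incl_injective (by
    rw [LCBimodule.Hom.map_left, incl_proj, incl_d, smul_sub, relFree.smul_mk, relFree.smul_mk,
      relFree.mul_mk, mul_one])

/-- The defect formula for the projection, evaluated at 1 ⊗ a, is the Leibniz rule. -/
theorem d_mul (a b : A) : d η (a * b) = a • d η b + MulOpposite.op b • d η a := by
  have h := proj_op_smul b (relFree.mk η 1 a)
  rw [relFree.op_smul_mk, proj_mk, proj_mk, one_smul, one_smul, relFree.mul_mk, one_mul] at h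
  rw [h, add_comm]

/-- Balancing over R identifies 1 ⊗ η(r) with η(r) ⊗ 1. -/
theorem d_map (r : R) : d η (η r) = 0 :=
  incl_injective (by
    have h := map_zero (incl η).toContinuousLinearMap
    have h' := relFree.mk_mul (η := η) 1 r 1
    rw [one_mul, mul_one] at h'
    rw [LCBimodule.Hom.coe_toCLM] at h
    rw [h, incl_d, ← h', sub_self])

/-- Continuous linear maps on `Ω¹_R(A)` are determined by their values at the forms `a db`. -/
theorem ext {Z : Type*} [AddCommGroup Z] [Module ℂ Z] [TopologicalSpace Z]
    [T2Space Z] {φ ψ : relForms η →L[ℂ] Z} (h : ∀ a b : A, φ (a • d η b) = ψ (a • d η b))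
    (ω : relForms η) : φ ω = ψ ω := by
  -- Since ω = proj (incl ω), a map on forms is determined by its composite with the projection,
  -- which takes a ⊗ b to a db.
  have := relFree.ext (φ := φ.comp (proj η)) (ψ := ψ.comp (proj η))
    (fun a b => by simpa only [ContinuousLinearMap.comp_apply, proj_mk] using h a b) (incl η ω)
  simpa only [ContinuousLinearMap.comp_apply, proj_incl] using this

/-- The bimodule morphism `Ω¹_R(A) → X`, `a db ↦ a • D b` given by a derivation `D` that vanishes
on `R`. -/
theorem exists_lift {X : HatBimodule A A} (D : A →L[ℂ] X)
    (hD : ∀ a b, D (a * b) = a • D b + MulOpposite.op b • D a) (hη : ∀ r, D (η r) = 0) :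
    ∃ φ : (relForms η).Hom X, ∀ a b : A, φ (a • d η b) = a • D b := by
  have : IsCompleteLCS X := {}
  -- The bilinear map (a, b) ↦ a·D(b) is defined on all of A ⊗̂_R A; it is balanced because D
  -- vanishes on R.
  obtain ⟨ψ, hψ⟩ := relFree.exists_lift (η := η) (smulBilin D) (continuous_smulBilin D)
    fun x r y => by
      rw [smulBilin_apply, smulBilin_apply, hD, hη, smul_zero, add_zero, mul_smul]
  have hl (a : A) (t : relFree η) : ψ (a • t) = a • ψ t :=
    relFree.ext (φ := ψ.comp (smulCLM _ a)) (ψ := (smulCLM X a).comp ψ) (fun b c => by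
      change ψ (a • relFree.mk η b c) = a • ψ (relFree.mk η b c)
      rw [relFree.smul_mk, hψ, hψ, smulBilin_apply, smulBilin_apply, mul_smul]) t
  -- Right linearity of ψ fails by `mul t • D a`, which disappears once ψ is restricted to the
  -- kernel of multiplication.
  have hr (a : A) (t : relFree η) :
      ψ (MulOpposite.op a • t) = MulOpposite.op a • ψ t + relFree.mul η t • D a :=
    relFree.ext (φ := ψ.comp (opSMulCLM _ (MulOpposite.op a)))
      (ψ := (opSMulCLM X (MulOpposite.op a)).comp ψ +
        ContinuousLinearMap.comp ⟨(smulBilin (.id ℂ X)).flip (D a),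
          continuous_id.smul continuous_const⟩ (relFree.mul η)) (fun b c => by
      change ψ (MulOpposite.op a • relFree.mk η b c) =
        MulOpposite.op a • ψ (relFree.mk η b c) + relFree.mul η (relFree.mk η b c) • D a
      rw [relFree.op_smul_mk, hψ, hψ, smulBilin_apply, smulBilin_apply, hD, relFree.mul_mk,
        smul_add, mul_smul, smul_comm b (MulOpposite.op a) (D c), add_comm]) t
  refine ⟨⟨ψ.comp (incl η).toContinuousLinearMap, fun a ω => ?_, fun a ω => ?_⟩, fun a b => ?_⟩
  · change ψ (incl η (a • ω)) = a • ψ (incl η ω)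
    rw [LCBimodule.Hom.map_left, hl]
  · change ψ (incl η (MulOpposite.op a.unop • ω)) = MulOpposite.op a.unop • ψ (incl η ω)
    rw [LCBimodule.Hom.map_right, hr, mul_incl, zero_smul, add_zero]
  · change ψ (incl η (a • d η b)) = a • D b
    have h1 : D 1 = 0 := by simpa using hη 1
    rw [LCBimodule.Hom.map_left, incl_d, hl, map_sub, hψ, hψ, smulBilin_apply, smulBilin_apply,
      h1, smul_zero, sub_zero, one_smul]

end relForms

end Forms

/-! ### The square-zero extension attached to a derivation -/

section SquareZero

open HatBimodule

variable {A : Type u} [Ring A] [Algebra ℂ A] [UniformSpace A] [IsTensorHatAlgebra A]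
  {Y Z : HatBimodule A A}

theorem trivSqZeroExt_isLCS : IsLCS (TrivSqZeroExt A Y) where
  toLocallyConvexSpace := inferInstanceAs (LocallyConvexSpace ℝ (A × Y))

/-- The subalgebra `{(a, y) | σ y = D a}` of the trivial square-zero extension `A ⋉ Y`. -/
def derivationPullback (σ : Y.Hom Z) (D : A →L[ℂ] Z)
    (hD : ∀ a b, D (a * b) = a • D b + MulOpposite.op b • D a) :
    Subalgebra ℂ (TrivSqZeroExt A Y) where
  carrier := {x | σ.toContinuousLinearMap x.snd = D x.fst}
  mul_mem' {x y} hx hy := by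
    have h1 (a : A) (y : Y) : σ.toContinuousLinearMap (a • y) = a • σ.toContinuousLinearMap y :=
      σ.map_left a y
    have h2 (a : Aᵐᵒᵖ) (y : Y) : σ.toContinuousLinearMap (a • y) = a • σ.toContinuousLinearMap y :=
      σ.map_right a y
    simp only [Set.mem_ofPred_eq] at hx hy ⊢
    rw [TrivSqZeroExt.snd_mul, TrivSqZeroExt.fst_mul, map_add, h1, h2, hx, hy, hD]
  add_mem' {x y} hx hy := by
    simp only [Set.mem_ofPred_eq] at hx hy ⊢
    rw [TrivSqZeroExt.snd_add, TrivSqZeroExt.fst_add, map_add, map_add, hx, hy]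
  algebraMap_mem' z := by
    -- The unit of A ⋉ Y is (1, 0), so the subalgebra contains it only because a derivation kills 1.
    have h1 : D 1 = 0 := by
      have := hD 1 1
      rwa [mul_one, one_smul, MulOpposite.op_one, one_smul, left_eq_add] at this
    simp only [Set.mem_ofPred_eq]
    rw [TrivSqZeroExt.algebraMap_eq_inl', TrivSqZeroExt.snd_inl, TrivSqZeroExt.fst_inl, map_zero,
      Algebra.algebraMap_eq_smul_one, map_smul, h1, smul_zero]

variable {σ : Y.Hom Z} {D : A →L[ℂ] Z} {hD : ∀ a b, D (a * b) = a • D b + MulOpposite.op b • D a}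

theorem mem_derivationPullback {x : TrivSqZeroExt A Y} :
    x ∈ derivationPullback σ D hD ↔ σ x.snd = D x.fst := Iff.rfl

/-- This is the equalizer of two continuous maps into the Hausdorff space Z. Closedness is what
makes the pullback complete, so that relative quasi-freeness applies to it. -/
theorem isClosed_derivationPullback :
    IsClosed (derivationPullback σ D hD : Set (TrivSqZeroExt A Y)) :=
  isClosed_eq (σ.continuous.comp TrivSqZeroExt.continuous_snd)
    (D.continuous.comp TrivSqZeroExt.continuous_fst)

instance : IsTensorHatAlgebra (derivationPullback σ D hD) :=
  have := trivSqZeroExt_isLCS (Y := Y)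
  have : CompleteSpace (derivationPullback σ D hD) :=
    isClosed_derivationPullback.completeSpace_coe
  have : IsLCS (derivationPullback σ D hD) :=
    submodule_isLCS (Subalgebra.toSubmodule (derivationPullback σ D hD))
  have : ContinuousMul (derivationPullback σ D hD) :=
    ⟨Continuous.subtype_mk ((continuous_subtype_val.comp continuous_fst).mul
      (continuous_subtype_val.comp continuous_snd)) _⟩
  {}

end SquareZero

/-! ### The projective resolution by forms -/

section Projective

open HatBimodule

variable {A R : Type u} [Ring A] [Algebra ℂ A] [UniformSpace A] [IsTensorHatAlgebra A]
  [Ring R] [Algebra ℂ R] [UniformSpace R] {η : R →A[ℂ] A}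

/-- Over a relatively quasi-free algebra, derivations that vanish on `R` lift along morphisms that
are split over `R`. -/
theorem IsRelativelyQuasiFree.exists_derivation_lift (hA : IsRelativelyQuasiFree η)
    {Y Z : HatBimodule A A} (σ : Y.Hom Z) (s : Z →L[ℂ] Y) (hs : IsRelMorphism η η s)
    (hσ : ∀ z, σ (s z) = z) (D : A →L[ℂ] Z)
    (hD : ∀ a b, D (a * b) = a • D b + MulOpposite.op b • D a) (hη : ∀ r, D (η r) = 0) :
    ∃ D' : A →L[ℂ] Y, (∀ a b, D' (a * b) = a • D' b + MulOpposite.op b • D' a) ∧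
      (∀ r, D' (η r) = 0) ∧ ∀ a, σ (D' a) = D a := by
  let E := derivationPullback σ D hD
  have hσ0 : σ 0 = 0 := map_zero σ.toContinuousLinearMap
  -- The structure map is r ↦ (η(r), 0). It lands in the pullback because D vanishes on R.
  let ηE : R →A[ℂ] E :=
    { toAlgHom := ((TrivSqZeroExt.inlAlgHom ℂ A Y).comp η.toAlgHom).codRestrict E fun r =>
        mem_derivationPullback.2 (hσ0.trans (hη r).symm)
      cont := Continuous.subtype_mk (TrivSqZeroExt.continuous_inl.comp η.cont) _ }
  let π : E →A[ℂ] A :=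
    { toAlgHom := (TrivSqZeroExt.fstHom ℂ A Y).comp E.val
      cont := TrivSqZeroExt.continuous_fst.comp continuous_subtype_val }
  -- The section a ↦ (a, s(D a)) witnesses admissibility. It is R-bilinear because D, being zero on
  -- R, satisfies D(η(r)a) = η(r)·D(a) and D(aη(r)) = D(a)·η(r), and s respects the R-actions.
  let t : A →L[ℂ] E :=
    { toFun a := ⟨(a, s (D a)), hσ _⟩
      map_add' a b := Subtype.ext (TrivSqZeroExt.ext rfl (map_add (s.comp D) a b))
      map_smul' z a := Subtype.ext (TrivSqZeroExt.ext rfl (map_smul (s.comp D) z a))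
      cont := Continuous.subtype_mk (continuous_id.prodMk (s.comp D).continuous) _ }
  obtain ⟨j, hj, hjη⟩ := hA E ηE π rfl
    (fun x y hx hy => by
      have hx' : x.1.fst = 0 := hx
      have hy' : y.1.fst = 0 := hy
      refine Subtype.ext (TrivSqZeroExt.ext ?_ ?_)
      · change x.1.fst * y.1.fst = 0
        rw [hx', zero_mul]
      · change x.1.fst • y.1.snd + MulOpposite.op y.1.fst • x.1.snd = 0
        rw [hx', hy', zero_smul, MulOpposite.op_zero, zero_smul, add_zero])
    ⟨t, fun a => rfl, fun r a => by
      refine Subtype.ext (TrivSqZeroExt.ext rfl ?_)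
      change s (D (η r * a)) = η r • s (D a) + MulOpposite.op a • (0 : Y)
      rw [hD, hη, smul_zero, smul_zero, add_zero, add_zero, hs.1], fun r a => by
      refine Subtype.ext (TrivSqZeroExt.ext rfl ?_)
      change s (D (a * η r)) = a • (0 : Y) + MulOpposite.op (η r) • s (D a)
      rw [hD, hη, smul_zero, smul_zero, zero_add, zero_add, hs.2]⟩
  have hfst (a : A) : (j a).1.fst = a := DFunLike.congr_fun hj a
  -- The splitting has the form j(a) = (a, D'(a)). Multiplicativity of j is the Leibniz rule for D',
  -- compatibility with R is D'∘η = 0, and membership in the pullback is σ∘D' = D.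
  refine ⟨{ toFun a := (j a).1.snd
            map_add' a b := by rw [map_add]; rfl
            map_smul' z a := by rw [map_smul]; rfl
            cont := TrivSqZeroExt.continuous_snd.comp (continuous_subtype_val.comp j.cont) },
    fun a b => ?_, fun r => ?_, fun a => ?_⟩
  · change (j (a * b)).1.snd = a • (j b).1.snd + MulOpposite.op b • (j a).1.snd
    rw [map_mul]
    change (j a).1.fst • (j b).1.snd + MulOpposite.op (j b).1.fst • (j a).1.snd = _
    rw [hfst, hfst]
  · have h := DFunLike.congr_fun hjη r
    exact congrArg (fun x : E => x.1.snd) h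
  · have h := mem_derivationPullback.1 (j a).2
    rwa [hfst] at h

/-- A morphism out of the forms amounts to a derivation vanishing on R, so the lifting problem
becomes the one for derivations. -/
theorem relForms.isRelProjective (hA : IsRelativelyQuasiFree η) :
    IsRelProjective η η (relForms η) := by
  rintro Y Z σ ⟨s, hs, hσ⟩ φ
  have hl (a b : A) : φ (a • relForms.d η b) = a • φ (relForms.d η b) := φ.map_left _ _
  obtain ⟨D, hD, hDη, hσD⟩ := hA.exists_derivation_lift σ s hs hσ
    (φ.toContinuousLinearMap.comp (relForms.d η))
    (fun a b => by
      change φ.toContinuousLinearMap (relForms.d η (a * b)) =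
        a • φ (relForms.d η b) + MulOpposite.op b • φ (relForms.d η a)
      rw [relForms.d_mul, map_add, LCBimodule.Hom.coe_toCLM, LCBimodule.Hom.coe_toCLM,
        LCBimodule.Hom.map_left, LCBimodule.Hom.map_right])
    (fun r => by
      change φ.toContinuousLinearMap (relForms.d η (η r)) = 0
      rw [relForms.d_map, map_zero])
  obtain ⟨ψ, hψ⟩ := relForms.exists_lift D hD hDη
  refine ⟨ψ, relForms.ext (φ := σ.toContinuousLinearMap.comp ψ.toContinuousLinearMap)
    (ψ := φ.toContinuousLinearMap) fun a b => ?_⟩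
  change σ (ψ (a • relForms.d η b)) = φ (a • relForms.d η b)
  rw [hψ, LCBimodule.Hom.map_left, hσD, LCBimodule.Hom.map_left]
  rfl

/-- The bimodule morphism `A ⊗̂_R A → X`, `a ⊗ b ↦ a x b` given by an element `x` that commutes
with `R`. -/
theorem relFree.exists_hom {X : HatBimodule A A} (x : X)
    (hx : ∀ r, η r • x = MulOpposite.op (η r) • x) :
    ∃ φ : (relFree η).Hom X, ∀ a b : A, φ (relFree.mk η a b) = a • MulOpposite.op b • x := by
  -- The map a ⊗ b ↦ a·x·b is balanced over R precisely because x commutes with R.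
  have : IsCompleteLCS X := {}
  obtain ⟨ψ, hψ⟩ := relFree.exists_lift (η := η) (smulBilin (opSMulRight X x))
    (continuous_smulBilin _) fun a r b => by
      change (a * η r) • MulOpposite.op b • x = a • MulOpposite.op (η r * b) • x
      rw [SemigroupAction.mul_smul, smul_comm (η r) (MulOpposite.op b), hx,
        MulOpposite.op_mul, SemigroupAction.mul_smul]
  have hψ' (a b : A) : ψ (relFree.mk η a b) = a • MulOpposite.op b • x := hψ a b
  refine ⟨⟨ψ, fun a => relFree.ext (φ := ψ.comp (smulCLM _ a)) (ψ := (smulCLM X a).comp ψ)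
    fun b c => ?_, fun a => relFree.ext (φ := ψ.comp (opSMulCLM _ a)) (ψ := (opSMulCLM X a).comp ψ)
    fun b c => ?_⟩, hψ'⟩
  · change ψ (a • relFree.mk η b c) = a • ψ (relFree.mk η b c)
    rw [relFree.smul_mk, hψ', hψ', SemigroupAction.mul_smul]
  · change ψ (MulOpposite.op a.unop • relFree.mk η b c) =
      MulOpposite.op a.unop • ψ (relFree.mk η b c)
    rw [relFree.op_smul_mk, hψ', hψ', MulOpposite.op_mul, SemigroupAction.mul_smul, smul_comm b]

/-- A morphism out of A ⊗̂_R A amounts to the choice of an R-central element, the image of 1 ⊗ 1. An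
R-bimodule section carries R-central elements to R-central ones, so the lift sends 1 ⊗ 1 to `s (φ (1
⊗ 1))`. -/
theorem relFree.isRelProjective : IsRelProjective η η (relFree η) := by
  rintro Y Z σ ⟨s, hs, hσ⟩ φ
  obtain ⟨ψ, hψ⟩ := relFree.exists_hom (η := η) (s (φ (relFree.mk η 1 1))) fun r => by
    have h := relFree.mk_mul (η := η) 1 r 1
    rw [← hs.1, ← hs.2, ← LCBimodule.Hom.map_left, ← LCBimodule.Hom.map_right, relFree.smul_mk,
      relFree.op_smul_mk, mul_one, one_mul]
    rw [one_mul, mul_one] at h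
    rw [h]
  refine ⟨ψ, relFree.ext (φ := σ.toContinuousLinearMap.comp ψ.toContinuousLinearMap)
    (ψ := φ.toContinuousLinearMap) fun a b => ?_⟩
  change σ (ψ (relFree.mk η a b)) = φ (relFree.mk η a b)
  rw [hψ, LCBimodule.Hom.map_left, LCBimodule.Hom.map_right, hσ, ← LCBimodule.Hom.map_right,
    ← LCBimodule.Hom.map_left, relFree.op_smul_mk, relFree.smul_mk, one_mul, mul_one]

theorem zero_isRelProjective : IsRelProjective η η (zero A) := fun Y _ σ _ φ =>
  ⟨Hom.zero _ Y, fun x => by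
    rw [Subsingleton.elim x 0]
    exact (map_zero σ.toContinuousLinearMap).trans (map_zero φ.toContinuousLinearMap).symm⟩

/-- A complex of the form `0 ← M ← P₀ ← P₁ ← 0` splits as soon as it has a contracting homotopy
in the degrees that matter. -/
theorem Splits.of_subsingleton {A B R S : Type u}
    [Ring A] [Algebra ℂ A] [UniformSpace A] [IsTensorHatAlgebra A]
    [Ring B] [Algebra ℂ B] [UniformSpace B] [IsTensorHatAlgebra B]
    [Ring R] [Algebra ℂ R] [UniformSpace R] [Ring S] [Algebra ℂ S] [UniformSpace S]
    {ηA : R →A[ℂ] A} {ηB : S →A[ℂ] B} {M : HatBimodule A B} {P : ℕ → HatBimodule A B}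
    {ε : (P 0).Hom M} {d : ∀ n, (P (n + 1)).Hom (P n)} (hP : ∀ n, Subsingleton (P (n + 2)))
    (h₀ : M →L[ℂ] P 0) (h₁ : P 0 →L[ℂ] P 1) (hh₀ : IsRelMorphism ηA ηB h₀)
    (hh₁ : IsRelMorphism ηA ηB h₁) (hε : ∀ m, ε (h₀ m) = m)
    (hd : ∀ x, h₀ (ε x) + d 0 (h₁ x) = x) (hd' : ∀ x, h₁ (d 0 x) = x) : Splits ηA ηB ε d := by
  refine ⟨h₀, fun
    | 0 => h₁
    | _ + 1 => 0, hh₀, ?_, hε, hd, ?_⟩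
  · rintro (_ | n)
    · exact hh₁
    · exact ⟨fun r t => (smul_zero _).symm, fun r t => (smul_zero _).symm⟩
  · rintro (_ | n) x
    · change h₁ (d 0 x) + (d 1).toContinuousLinearMap 0 = x
      rw [hd', map_zero, add_zero]
    · exact (hP n).elim _ _

variable (η) in
/-- The bimodules in the resolution `0 ← A ← A ⊗̂_R A ← Ω¹_R(A) ← 0`. -/
noncomputable def formsResolution : ℕ → HatBimodule A A
  | 0 => relFree η
  | 1 => relForms η
  | _ + 2 => zero A

variable (η) in
/-- The differentials in the resolution `0 ← A ← A ⊗̂_R A ← Ω¹_R(A) ← 0`. -/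
noncomputable def formsResolution.d :
    ∀ n, (formsResolution η (n + 1)).Hom (formsResolution η n)
  | 0 => relForms.incl η
  | _ + 1 => Hom.zero _ _

/-- The homotopy consists of a ↦ a ⊗ 1 and the projection onto forms. Their R-linearity on the right
uses respectively the balancing of the tensor product and the vanishing of d on R. -/
theorem formsResolution.splits :
    Splits η η (P := formsResolution η) (relFree.mulHom η) (formsResolution.d η) := by
  have h1 (r : R) (a : A) :
      relFree.mkLeft (η := η) 1 (η r * a) = η r • relFree.mkLeft (η := η) 1 a := by
    rw [relFree.mkLeft_apply, relFree.mkLeft_apply, relFree.smul_mk]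
  have h2 (r : R) (a : A) : relFree.mkLeft (η := η) 1 (a * η r) =
      MulOpposite.op (η r) • relFree.mkLeft (η := η) 1 a := by
    rw [relFree.mkLeft_apply, relFree.mkLeft_apply, relFree.op_smul_mk, relFree.mk_mul, mul_one,
      one_mul]
  have h3 (r : R) (t : relFree η) : relForms.proj η (MulOpposite.op (η r) • t) =
      MulOpposite.op (η r) • relForms.proj η t := by
    rw [relForms.proj_op_smul, relForms.d_map, smul_zero, add_zero]
  have h4 (a : A) : relFree.mul η (relFree.mkLeft 1 a) = a := by
    rw [relFree.mkLeft_apply, relFree.mul_mk, mul_one]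
  have h5 (t : relFree η) :
      relFree.mkLeft 1 (relFree.mul η t) + relForms.incl η (relForms.proj η t) = t := by
    rw [relFree.mkLeft_apply, relForms.incl_proj, add_sub_cancel]
  exact Splits.of_subsingleton (fun n => inferInstanceAs (Subsingleton (zero A)))
    (relFree.mkLeft 1 : A →L[ℂ] relFree η) (relForms.proj η) ⟨h1, h2⟩
    ⟨fun r => relForms.proj_smul (η r), h3⟩ h4 h5 relForms.proj_incl

theorem formsResolution.isRelProjectiveResolution (hA : IsRelativelyQuasiFree η) :
    IsRelProjectiveResolution η η (P := formsResolution η) (relFree.mulHom η)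
      (formsResolution.d η) where
  projective
    | 0 => relFree.isRelProjective
    | 1 => relForms.isRelProjective hA
    | _ + 2 => zero_isRelProjective
  aug_comp_d := relForms.mul_incl
  d_comp_d
    | 0, _ => map_zero (relForms.incl η).toContinuousLinearMap
    | _ + 1, _ => rfl
  splits := formsResolution.splits

end Projective

/-! ### Maps out of B ⊗̂_A P ⊗̂_A B -/

namespace extendScalars

open HatBimodule

variable {A B : Type u} [Ring A] [Algebra ℂ A] [UniformSpace A] [IsTensorHatAlgebra A]
  [Ring B] [Algebra ℂ B] [UniformSpace B] [IsTensorHatAlgebra B] (f : A →A[ℂ] B)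
  (P : HatBimodule A A)

/-- The canonical map `P → B ⊗̂_A P ⊗̂_A B`, `p ↦ 1 ⊗ p ⊗ 1`. -/
noncomputable def unit : P →L[ℂ] extendScalars f P := (mkLeft f P 1).comp (leftExtend.mkRight f P 1)

variable {f P}

theorem unit_apply (p : P) : unit f P p = mk f P (leftExtend.mk f P 1 p) 1 := by
  rw [← leftExtend.mkRight_apply, ← mkLeft_apply]
  rfl

/-- Elements 1 ⊗ p ⊗ 1 generate under the two actions of B, so the computations below can be
expressed through `unit` and the actions. -/
theorem mk_mk (b : B) (p : P) (c : B) :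
    mk f P (leftExtend.mk f P b p) c = b • MulOpposite.op c • unit f P p := by
  rw [unit_apply, op_smul_mk, smul_mk, leftExtend.smul_mk, mul_one, one_mul]

theorem unit_smul (a : A) (p : P) : unit f P (a • p) = f a • unit f P p := by
  rw [unit_apply, unit_apply, smul_mk, leftExtend.smul_mk, mul_one, ← leftExtend.mk_mul, one_mul]

theorem unit_op_smul (a : A) (p : P) :
    unit f P (MulOpposite.op a • p) = MulOpposite.op (f a) • unit f P p := by
  rw [unit_apply, unit_apply, op_smul_mk, one_mul, ← leftExtend.op_smul_mk, ← mk_mul, mul_one]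

theorem map_unit {Q : HatBimodule A A} (φ : P.Hom Q) (p : P) :
    extendScalarsMap f φ (unit f P p) = unit f Q (φ p) := by
  rw [unit_apply, unit_apply, map_mk]

/-- If `f` has dense range, continuous linear maps on `B ⊗̂_A P ⊗̂_A B` are determined by their
values at the elements `b ⊗ p ⊗ 1`. -/
theorem ext_of_denseRange (hf : DenseRange f) {Z : Type*} [AddCommGroup Z] [Module ℂ Z]
    [TopologicalSpace Z] [T2Space Z] {φ ψ : extendScalars f P →L[ℂ] Z}
    (h : ∀ (b : B) p, φ (b • unit f P p) = ψ (b • unit f P p)) (x : extendScalars f P) :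
    φ x = ψ x := by
  refine ext (fun b p c => ?_) x
  -- With b and p fixed, both sides are continuous in c. Density reduces to c = f(a), and b ⊗ p ⊗
  -- f(a) = b ⊗ p·a ⊗ 1.
  rw [mk_mk, smul_comm]
  have hc (χ : extendScalars f P →L[ℂ] Z) :
      Continuous fun c : B => χ (MulOpposite.op c • b • unit f P p) :=
    χ.continuous.comp (opSMulRight _ (b • unit f P p)).continuous
  refine congrFun (hf.equalizer (hc φ) (hc ψ) (funext fun a => ?_)) c
  change φ (MulOpposite.op (f a) • b • unit f P p) = ψ (MulOpposite.op (f a) • b • unit f P p)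
  rw [← smul_comm b, ← unit_op_smul, h]

/-- A continuous linear map `κ : P → X` that is a morphism of left modules, and a morphism of right
modules up to the derivation `δ`, induces a map on `B ⊗̂_A P ⊗̂_A B`. -/
theorem exists_lift_derivation {X : HatBimodule B B} (κ : P →L[ℂ] X) (m : P →L[ℂ] B)
    (δ : B →L[ℂ] X) (hδ : ∀ a b, δ (a * b) = a • δ b + MulOpposite.op b • δ a)
    (hκ : ∀ (a : A) p, κ (a • p) = f a • κ p)
    (hκ' : ∀ (a : A) p, κ (MulOpposite.op a • p) = MulOpposite.op (f a) • κ p + m p • δ (f a))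
    (hm : ∀ (a : A) p, m (a • p) = f a * m p)
    (hm' : ∀ (a : A) p, m (MulOpposite.op a • p) = m p * f a) :
    ∃ φ : extendScalars f P →L[ℂ] X, (∀ (b : B) p, φ (b • unit f P p) = b • κ p) ∧
      (∀ (b : B) x, φ (b • x) = b • φ x) ∧
      ∀ c : B, δ c = 0 → ∀ x, φ (MulOpposite.op c • x) = MulOpposite.op c • φ x := by
  have : IsCompleteLCS X := {}
  obtain ⟨l, hl, -⟩ := leftExtend.exists_lift (f := f) (P := P) κ hκ
  obtain ⟨n, hn⟩ : ∃ n : leftExtend f P →L[ℂ] B, ∀ b p, n (leftExtend.mk f P b p) = b * m p := by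
    obtain ⟨n, hn, -⟩ := leftExtend.exists_lift (f := f) (P := P) (X := regular B) m hm
    exact ⟨n, hn⟩
  have hadd (c d : B) (x : X) :
      MulOpposite.op (c + d) • x = MulOpposite.op c • x + MulOpposite.op d • x := by
    rw [MulOpposite.op_add, add_smul]
  have hsmul (z : ℂ) (c : B) (x : X) :
      MulOpposite.op (z • c) • x = z • MulOpposite.op c • x := by
    rw [MulOpposite.op_smul, smul_assoc]
  -- On elementary tensors the resulting map is b ⊗ p ⊗ c ↦ b·(κ(p)·c + m(p)·δ(c)).
  let β : leftExtend f P →ₗ[ℂ] B →ₗ[ℂ] X :=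
    LinearMap.mk₂ ℂ (fun t c => MulOpposite.op c • l t + n t • δ c)
      (fun s t c => by rw [map_add, map_add, smul_add, add_smul]; abel)
      (fun z t c => by
        rw [map_smul, map_smul, smul_add, smul_assoc, smul_comm z (MulOpposite.op c)])
      (fun t c d => by rw [map_add, smul_add, hadd]; abel)
      (fun z t c => by rw [map_smul, hsmul, smul_add, smul_comm (n t) z])
  have hβ (t : leftExtend f P) (c : B) : β t c = MulOpposite.op c • l t + n t • δ c := rfl
  have hβc : Continuous fun z : leftExtend f P × B => β z.1 z.2 := by
    have h1 : Continuous fun z : leftExtend f P × B => MulOpposite.op z.2 • l z.1 :=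
      (MulOpposite.continuous_op.comp continuous_snd).smul (l.continuous.comp continuous_fst)
    have h2 : Continuous fun z : leftExtend f P × B => n z.1 • δ z.2 :=
      (n.continuous.comp continuous_fst).smul (δ.continuous.comp continuous_snd)
    exact h1.add h2
  let βL (c : B) : leftExtend f P →L[ℂ] X :=
    ⟨β.flip c, hβc.comp (continuous_id.prodMk continuous_const)⟩
  -- Moving a from p to c, the defect m(p)·δ(f(a))·c of κ is exactly the extra Leibniz term in
  -- m(p)·δ(f(a)c); hence β is balanced, although neither summand need be.
  obtain ⟨φ, hφ⟩ := exists_lift β hβc fun t a c => by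
    refine leftExtend.ext (φ := (βL c).comp (opSMulCLM _ (MulOpposite.op a)))
      (ψ := βL (f a * c)) (fun b p => ?_) t
    change β (MulOpposite.op a • leftExtend.mk f P b p) c = β (leftExtend.mk f P b p) (f a * c)
    rw [leftExtend.op_smul_mk, hβ, hβ, hl, hl, hn, hn, hκ', hm', hδ, MulOpposite.op_mul, ← mul_assoc]
    simp only [smul_add, mul_smul]
    rw [smul_comm b (MulOpposite.op (f a)), smul_comm (m p) (MulOpposite.op c) (δ (f a)),
      smul_comm b (MulOpposite.op c)]
    abel
  have hφ' (b : B) (p : P) (c : B) : φ (b • MulOpposite.op c • unit f P p) =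
      b • (MulOpposite.op c • κ p + m p • δ c) := by
    rw [← mk_mk, hφ, hβ, hl, hn, smul_add, mul_smul, smul_comm b (MulOpposite.op c)]
  have h1 : δ 1 = 0 := by
    have := hδ 1 1
    rwa [mul_one, one_smul, MulOpposite.op_one, one_smul, left_eq_add] at this
  refine ⟨φ, fun b p => ?_, fun b x => ?_, fun c hc x => ?_⟩
  · have := hφ' b p 1
    rwa [MulOpposite.op_one, one_smul, one_smul, h1, smul_zero, add_zero] at this
  · refine ext (φ := φ.comp (smulCLM _ b)) (ψ := (smulCLM X b).comp φ) (fun b' p c => ?_) x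
    change φ (b • mk f P (leftExtend.mk f P b' p) c) = b • φ (mk f P (leftExtend.mk f P b' p) c)
    rw [mk_mk, ← mul_smul, hφ', hφ', mul_smul]
  -- If δ(c) = 0, then δ(c'c) = δ(c')·c, so right multiplication by c passes through both summands.
  · refine ext (φ := φ.comp (opSMulCLM _ (MulOpposite.op c)))
      (ψ := (opSMulCLM X (MulOpposite.op c)).comp φ) (fun b p c' => ?_) x
    change φ (MulOpposite.op c • mk f P (leftExtend.mk f P b p) c') =
      MulOpposite.op c • φ (mk f P (leftExtend.mk f P b p) c')
    rw [op_smul_mk, mk_mk, mk_mk, hφ', hφ', hδ, hc, smul_zero, zero_add, MulOpposite.op_mul,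
      mul_smul, smul_comm (m p), ← smul_add, smul_comm b]

end extendScalars

/-! ### The contracting homotopy after extension of scalars -/

section Main

open HatBimodule

variable {A B R S : Type u} [Ring A] [Algebra ℂ A] [UniformSpace A] [IsTensorHatAlgebra A]
  [Ring B] [Algebra ℂ B] [UniformSpace B] [IsTensorHatAlgebra B]
  [Ring R] [Algebra ℂ R] [UniformSpace R] [Ring S] [Algebra ℂ S] [UniformSpace S]
  {ηA : R →A[ℂ] A} {ηB : S →A[ℂ] B} {f : A →A[ℂ] B} {g : R →A[ℂ] S}

/-- Continuous maps into a Hausdorff algebra that agree on a dense subset agree everywhere. -/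
theorem isHatEpimorphism_of_denseRange (hf : DenseRange f) : IsHatEpimorphism f :=
  fun _ _ _ _ _ φ ψ h => DFunLike.coe_injective
    (hf.equalizer φ.cont ψ.cont (congrArg DFunLike.coe h))

/-- Property (UDE) for the derivation `a ↦ 1 ⊗ da ⊗ 1`. -/
theorem PropertyUDE.exists_derivation (hUDE : PropertyUDE f) (η : R →A[ℂ] A) :
    ∃ δ : B →L[ℂ] extendScalars f (relForms η),
      (∀ a b, δ (a * b) = a • δ b + MulOpposite.op b • δ a) ∧
      ∀ a, δ (f a) = extendScalars.unit f (relForms η) (relForms.d η a) := by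
  let D : Der f (extendScalars f (relForms η)) :=
    ⟨(extendScalars.unit f (relForms η)).comp (relForms.d η), fun a b => by
      change extendScalars.unit f _ (relForms.d η (a * b)) =
        f a • extendScalars.unit f _ (relForms.d η b) +
          MulOpposite.op (f b) • extendScalars.unit f _ (relForms.d η a)
      rw [relForms.d_mul, map_add, extendScalars.unit_smul, extendScalars.unit_op_smul]⟩
  -- (UDE) is applied with coefficients in the bimodule B ⊗̂_A Ω¹_R(A) ⊗̂_A B itself.
  obtain ⟨δ, hδ⟩ := (hUDE _).2 D
  exact ⟨δ.1, δ.2, fun a => DFunLike.congr_fun (congrArg Subtype.val hδ) a⟩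

/-- This is the degree-zero part of the homotopy over S. It factors through B: first b ⊗ a ⊗ c ↦ b
f(a) c, then b ↦ b·u with u = 1 ⊗ (1 ⊗ 1) ⊗ 1. On elements b ⊗ a ⊗ 1 it reproduces the original
section a ↦ a ⊗ 1. -/
theorem exists_extendScalars_section (hfg : IsRSHomomorphism ηA ηB f g) (hg : DenseRange g) :
    ∃ h : extendScalars f (regular A) →L[ℂ] extendScalars f (relFree ηA),
      IsRelMorphism ηB ηB h ∧ ∀ (b : B) (a : A), h (b • extendScalars.unit f (regular A) a) =
        b • extendScalars.unit f (relFree ηA) (relFree.mk ηA a 1) := by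
  have hfg' (r : R) : ηB (g r) = f (ηA r) := (DFunLike.congr_fun hfg r).symm
  obtain ⟨φ, hφ, hφl, hφr⟩ : ∃ φ : extendScalars f (regular A) →L[ℂ] B,
      (∀ (b : B) (a : A), φ (b • extendScalars.unit f (regular A) a) = b * f a) ∧
      (∀ (b : B) x, φ (b • x) = b * φ x) ∧
      ∀ (c : B) x, φ (MulOpposite.op c • x) = φ x * c := by
    -- Multiplication arises from κ = f with zero derivation, so right linearity holds over all of
    -- B.
    obtain ⟨φ, hφ, hφl, hφr⟩ := extendScalars.exists_lift_derivation (P := regular A)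
      (X := regular B) (f := f) f.toContinuousLinearMap 0 0
      (fun a b => by simp) (fun a (p : A) => map_mul f a p)
      (fun a p => by
        refine (map_mul f (show A from p) a).trans ?_
        rw [zero_apply, zero_smul, add_zero]
        rfl)
      (fun a p => (mul_zero _).symm) (fun a p => (zero_mul _).symm)
    exact ⟨φ, hφ, hφl, fun c => hφr c rfl⟩
  let u := extendScalars.unit f (relFree ηA) (relFree.mk ηA 1 1)
  let k : B →L[ℂ] extendScalars f (relFree ηA) :=
    ⟨(smulBilin (.id ℂ _)).flip u, continuous_id.smul continuous_const⟩
  have hk (b : B) : k b = b • u := rfl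
  have hu (a : A) : f a • u = extendScalars.unit f (relFree ηA) (relFree.mk ηA a 1) := by
    rw [← extendScalars.unit_smul, relFree.smul_mk, mul_one]
  -- The second factor is right S-linear because u is S-central. For s = g(r) centrality is the
  -- balancing over R of 1 ⊗ 1; density of g(R) and continuity of the actions extend it to S.
  have hS (s : S) : ηB s • u = MulOpposite.op (ηB s) • u := by
    have h1 : Continuous fun s => ηB s • u := ηB.cont.smul continuous_const
    have h2 : Continuous fun s => MulOpposite.op (ηB s) • u :=
      (MulOpposite.continuous_op.comp ηB.cont).smul continuous_const
    refine congrFun (hg.equalizer h1 h2 (funext fun r => ?_)) s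
    have h := relFree.mk_mul (η := ηA) 1 r 1
    rw [one_mul, mul_one] at h
    change ηB (g r) • u = MulOpposite.op (ηB (g r)) • u
    rw [hfg', hu, ← extendScalars.unit_op_smul, relFree.op_smul_mk, one_mul, h]
  refine ⟨k.comp φ, ⟨fun s x => ?_, fun s x => ?_⟩, fun b a => ?_⟩
  · change k (φ (ηB s • x)) = ηB s • k (φ x)
    rw [hφl, hk, hk, mul_smul]
  · change k (φ (MulOpposite.op (ηB s) • x)) = MulOpposite.op (ηB s) • k (φ x)
    rw [hφr, hk, hk, mul_smul, hS, smul_comm]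
  · change k (φ (b • extendScalars.unit f (regular A) a)) = _
    rw [hφ, hk, mul_smul, hu]

/-- This is the degree-one part of the homotopy: b ⊗ (a ⊗ a') ⊗ c ↦ b f(a)·δ(f(a')c), where δ is the
derivation obtained from (UDE). It is the projection x ⊗ y ↦ x dy transported to B. -/
theorem exists_extendScalars_retraction (hfg : IsRSHomomorphism ηA ηB f g) (hg : DenseRange g)
    (hUDE : PropertyUDE f) :
    ∃ h : extendScalars f (relFree ηA) →L[ℂ] extendScalars f (relForms ηA),
      IsRelMorphism ηB ηB h ∧ ∀ (b : B) t, h (b • extendScalars.unit f (relFree ηA) t) =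
        b • extendScalars.unit f (relForms ηA) (relForms.proj ηA t) := by
  have hfg' (r : R) : ηB (g r) = f (ηA r) := (DFunLike.congr_fun hfg r).symm
  obtain ⟨δ, hδ, hδf⟩ := hUDE.exists_derivation ηA
  -- On g(R) this is the vanishing of d on the image of R, since δ∘f = 1 ⊗ d(-) ⊗ 1; density does
  -- the rest. It is what gives right S-linearity.
  have hS (s : S) : δ (ηB s) = 0 := by
    refine congrFun (hg.equalizer (δ.continuous.comp ηB.cont) continuous_const
      (funext fun r => ?_)) s
    change δ (ηB (g r)) = 0
    rw [hfg', hδf, relForms.d_map, map_zero]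
  -- Here κ(t) = 1 ⊗ proj(t) ⊗ 1 and m = f∘mul, so the hypothesis on the right defect of κ is
  -- `relForms.proj_op_smul` pushed forward by `unit`.
  obtain ⟨h, hh, hl, hr⟩ := extendScalars.exists_lift_derivation (f := f)
    ((extendScalars.unit f (relForms ηA)).comp (relForms.proj ηA))
    (f.toContinuousLinearMap.comp (relFree.mul ηA)) δ hδ
    (fun a p => by
      change extendScalars.unit f _ (relForms.proj ηA (a • p)) =
        f a • extendScalars.unit f _ (relForms.proj ηA p)
      rw [relForms.proj_smul, extendScalars.unit_smul])
    (fun a p => by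
      change extendScalars.unit f _ (relForms.proj ηA (MulOpposite.op a • p)) =
        MulOpposite.op (f a) • extendScalars.unit f _ (relForms.proj ηA p) +
          f (relFree.mul ηA p) • δ (f a)
      rw [relForms.proj_op_smul, map_add, extendScalars.unit_smul, extendScalars.unit_op_smul, hδf])
    (fun a p => by
      change f (relFree.mul ηA (a • p)) = f a * f (relFree.mul ηA p)
      rw [relFree.mul_smul, map_mul])
    (fun a p => by
      change f (relFree.mul ηA (MulOpposite.op a • p)) = f (relFree.mul ηA p) * f a
      rw [relFree.mul_op_smul, map_mul])
  exact ⟨h, ⟨fun s => hl _, fun s => hr _ (hS s)⟩, hh⟩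

/-- By density of f each homotopy identity is tested at b ⊗ p ⊗ 1. There both homotopy maps are b
times the image of the original ones, and the identity follows from its counterpart for the
resolution of A. -/
theorem extendScalars_formsResolution_splits (hfg : IsRSHomomorphism ηA ηB f g)
    (hg : DenseRange g) (hf : DenseRange f) (hUDE : PropertyUDE f) :
    Splits ηB ηB (P := fun n => extendScalars f (formsResolution ηA n))
      (extendScalarsMap f (relFree.mulHom ηA))
      fun n => extendScalarsMap f (formsResolution.d ηA n) := by
  obtain ⟨h₀, hh₀, H₀⟩ := exists_extendScalars_section hfg hg
  obtain ⟨h₁, hh₁, H₁⟩ := exists_extendScalars_retraction hfg hg hUDE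
  have e₀ (x : extendScalars f (regular A)) :
      extendScalarsMap f (relFree.mulHom ηA) (h₀ x) = x := by
    refine extendScalars.ext_of_denseRange hf (φ := (extendScalarsMap f
      (relFree.mulHom ηA)).toContinuousLinearMap.comp h₀) (ψ := .id ℂ _) (fun b (a : A) => ?_) x
    change extendScalarsMap f (relFree.mulHom ηA) (h₀ (b • extendScalars.unit f (regular A) a)) =
      b • extendScalars.unit f (regular A) a
    rw [H₀, LCBimodule.Hom.map_left, extendScalars.map_unit, relFree.mulHom_apply, relFree.mul_mk,
      mul_one]
  have e₁ (x : extendScalars f (relFree ηA)) : h₀ (extendScalarsMap f (relFree.mulHom ηA) x) +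
      extendScalarsMap f (relForms.incl ηA) (h₁ x) = x := by
    refine extendScalars.ext_of_denseRange hf (φ := h₀.comp (extendScalarsMap f
      (relFree.mulHom ηA)).toContinuousLinearMap + (extendScalarsMap f
      (relForms.incl ηA)).toContinuousLinearMap.comp h₁) (ψ := .id ℂ _) (fun b t => ?_) x
    change h₀ (extendScalarsMap f (relFree.mulHom ηA) (b • extendScalars.unit f (relFree ηA) t)) +
      extendScalarsMap f (relForms.incl ηA) (h₁ (b • extendScalars.unit f (relFree ηA) t)) =
      b • extendScalars.unit f (relFree ηA) t
    rw [H₁, LCBimodule.Hom.map_left, LCBimodule.Hom.map_left, extendScalars.map_unit,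
      extendScalars.map_unit, relForms.incl_proj, relFree.mulHom_apply, H₀, map_sub, smul_sub,
      add_sub_cancel]
  have e₂ (x : extendScalars f (relForms ηA)) :
      h₁ (extendScalarsMap f (relForms.incl ηA) x) = x := by
    refine extendScalars.ext_of_denseRange hf (φ := h₁.comp (extendScalarsMap f
      (relForms.incl ηA)).toContinuousLinearMap) (ψ := .id ℂ _) (fun b ω => ?_) x
    change h₁ (extendScalarsMap f (relForms.incl ηA) (b • extendScalars.unit f (relForms ηA) ω)) =
      b • extendScalars.unit f (relForms ηA) ω
    rw [LCBimodule.Hom.map_left, extendScalars.map_unit, H₁, relForms.proj_incl]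
  have hP (n : ℕ) : Subsingleton (extendScalars f (formsResolution ηA (n + 2))) := by
    have : Subsingleton (formsResolution ηA (n + 2)) := inferInstanceAs (Subsingleton (zero A))
    exact ⟨fun x y => (extendScalars.subsingleton x).trans (extendScalars.subsingleton y).symm⟩
  exact Splits.of_subsingleton hP h₀ h₁ hh₀ hh₁ e₀ e₁ e₂

end Main

theorem mainTheorem3 {R S A B : Type u}
    [Ring R] [Algebra ℂ R] [UniformSpace R] [IsTensorHatAlgebra R]
    [Ring S] [Algebra ℂ S] [UniformSpace S] [IsTensorHatAlgebra S]
    [Ring A] [Algebra ℂ A] [UniformSpace A] [IsTensorHatAlgebra A]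
    [Ring B] [Algebra ℂ B] [UniformSpace B] [IsTensorHatAlgebra B]
    (ηA : R →A[ℂ] A) (ηB : S →A[ℂ] B) (f : A →A[ℂ] B) (g : R →A[ℂ] S)
    (hfg : IsRSHomomorphism ηA ηB f g)
    (hg : DenseRange g) (hf : DenseRange f) (hUDE : PropertyUDE f)
    (hA : IsRelativelyQuasiFree ηA) :
    IsTwoSidedRelHomologicalEpi ηA ηB f :=
  ⟨isHatEpimorphism_of_denseRange hf, formsResolution ηA, relFree.mulHom ηA, formsResolution.d ηA,
    formsResolution.isRelProjectiveResolution hA,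
    extendScalars_formsResolution_splits hfg hg hf hUDE⟩
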